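/- Let $k,d\in\mathbb N$ with $d\ge 1$, $k>d/2$, and let $c>1$. Functions live on the torus $\mathbb T^d=\mathbb R^d/\mathbb Z^d$. Let $H^k_0(\mathbb T^d)$ be the space of real mean-zero functions in $H^k(\mathbb T^d)$, each identified with its continuous representative, with inner product $\langle f,g\rangle_{H^k_0}=\langle D^kf,D^kg\rangle_{L^2}=\sum_{i_1,\dots,i_k=1}^d\int_{\mathbb T^d}\partial_{i_1}\cdots\partial_{i_k}f\;\partial_{i_1}\cdots\partial_{i_k}g\,dx$ and norm $\|D^kf\|_{L^2}$. A cube is a set $B=\prod_{i=1}^d[a_i,a_i+h)\subseteq[0,1]^d$ with $0<h\le1$; $|B|$ denotes its volume. A system $\mathcal B$ of cubes is normal with constant $c$ if every cube $B$ contains some $\tilde B\in\mathcal B$ with $|\tilde B|\ge|B|/c$. For $n=N^d$ with $N\in\mathbb N$ let $\Gamma_n=\{(\tau_1/N,\dots,\tau_d/N):\tau_i\in\{0,\dots,N-1\}\}$ and $S_nf=(f(x))_{x\in\Gamma_n}$. For $y,\omega\in\mathbb R^{\Gamma_n}$ put $$\|y\|_{\mathcal B}=\sup_{B\in\mathcal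 B}\frac{\bigl|\sum_{x\in\Gamma_n\cap B}y(x)\bigr|}{\sqrt{\#(\Gamma_n\cap B)}},\qquad \|\omega\|_{\mathcal B^*}=\sup\Bigl\{\sum_{x\in\Gamma_n}\omega(x)v(x):\ v\in\mathbb R^{\Gamma_n},\ \|v\|_{\mathcal B}\le1\Bigr\}\in[0,\infty],$$ where the quotient is $0$ if $\Gamma_n\cap B=\emptyset$. Let $S_n^*:\mathbb R^{\Gamma_n}\to H^k_0(\mathbb T^d)$ be the adjoint of $S_n$, given by $\sum_{x\in\Gamma_n}u(x)\omega(x)=\langle u,S_n^*\omega\rangle_{H^k_0}$ for all $u\in H^k_0(\mathbb T^d)$. Given $y_n\in\mathbb R^{\Gamma_n}$ and $\gamma_n\in\mathbb R$, a MIND estimator $\hat f_{\gamma_n}$ is a minimizer of $\frac12\|D^kg\|_{L^2}^2$ over all $g\in H^k_0(\mathbb T^d)$ with $\|S_ng-y_n\|_{\mathcal B}\le\gamma_n$. For $f\in H^k_0(\mathbb T^d)$ define, for $t\ge0$, $$d_n(t)=\min_{\|\omega\|_{\mathcal B^*}\le t}\|D^kS_n^*\omega-D^kf\|_{L^2},\qquad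 c_n=\min_{t\ge0}\bigl(d_n(t)+(\gamma_nt)^{1/2}\bigr).$$ For $1\le q\le\infty$ let $\vartheta=\frac{k}{2k+d}$ if $q\le\frac{4k+2d}{d}$, $\vartheta=\frac{k-d/2+d/q}{2k}$ if $q\ge\frac{4k+2d}{d}$ (with $d/\infty=0$), and $\vartheta'=2k\vartheta/d$. Theorem. There exist $C>0$ and $n_0\in\mathbb N$, depending only on $k$, $d$ and $c$, such that for all $1\le q\le\infty$, every system $\mathcal B$ that is normal with constant $c$, every $n=N^d\ge n_0$, all $f\in H^k_0(\mathbb T^d)$, $y_n\in\mathbb R^{\Gamma_n}$ and $\gamma_n\in\mathbb R$ with $\|S_nf-y_n\|_{\mathcal B}\le\gamma_n$, and every MIND estimator $\hat f_{\gamma_n}$, $$\|\hat f_{\gamma_n}-f\|_{L^q}\le C\max\Bigl\{\frac{\gamma_n^{2\vartheta}c_n^{1-2\vartheta}}{n^{\vartheta}},\ \frac{\gamma_n}{n^{1/2}},\ \frac{c_n}{n^{\vartheta'}}\Bigr\}.$$ -/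

import Mathlib

open MeasureTheory
open scoped NNReal ENNReal

noncomputable section

namespace MIND

/-! ### Periodic functions and Sobolev spaces on the torus `ℝ^d / ℤ^d`

Functions on the torus are represented by `ℤ^d`-periodic functions on `ℝ^d`; integrals and
`L^q`-norms over the torus are taken over the fundamental domain `[0,1]^d`. -/

/-- Lebesgue measure on the fundamental domain `[0,1]^d`. -/
def torusMeasure (d : ℕ) : Measure (Fin d → ℝ) :=
  volume.restrict (Set.Icc (0 : Fin d → ℝ) 1)

/-- `f` is `ℤ^d`-periodic, that is, a function on the torus. -/
def IsPeriodic {d : ℕ} (f : (Fin d → ℝ) → ℝ) : Prop :=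
  ∀ (x : Fin d → ℝ) (z : Fin d → ℤ), f (fun i => x i + (z i : ℝ)) = f x

/-- The classical iterated partial derivative `∂_{I 0} ⋯ ∂_{I (m-1)} φ`. -/
def partialDeriv {d m : ℕ} (I : Fin m → Fin d) (φ : (Fin d → ℝ) → ℝ) (x : Fin d → ℝ) : ℝ :=
  iteratedFDeriv ℝ m φ x (fun j => Pi.single (I j) (1 : ℝ))

/-- `g` belongs to `L²` of the torus and is the weak partial derivative
`∂_{I 0} ⋯ ∂_{I (m-1)} f` on the torus: the test functions are the smooth periodic functions. -/
def IsWeakDeriv {d m : ℕ} (I : Fin m → Fin d) (f g : (Fin d → ℝ) → ℝ) : Prop :=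
  MemLp g 2 (torusMeasure d) ∧
    ∀ φ : (Fin d → ℝ) → ℝ, ContDiff ℝ ((⊤ : ℕ∞) : WithTop ℕ∞) φ → IsPeriodic φ →
      ∫ x, f x * partialDeriv I φ x ∂(torusMeasure d)
        = (-1 : ℝ) ^ m * ∫ x, g x * φ x ∂(torusMeasure d)

/-- The space `H^k_0` of the torus: mean zero functions all of whose weak partial derivatives up to
order `k` are in `L²`. It is only used for `k > d/2`, where every Sobolev function has a unique
continuous representative; elements of `H^k_0` are identified with this representative. -/
def SobolevZero (k d : ℕ) : Set ((Fin d → ℝ) → ℝ) :=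
  {f | Continuous f ∧ IsPeriodic f ∧ ∫ x, f x ∂(torusMeasure d) = 0 ∧
    ∀ m : ℕ, m ≤ k → ∀ I : Fin m → Fin d, ∃ g, IsWeakDeriv I f g}

open Classical in
/-- A choice (unique almost everywhere on `[0,1]^d`) of the weak partial derivative of `f`. -/
def weakDeriv {d m : ℕ} (I : Fin m → Fin d) (f : (Fin d → ℝ) → ℝ) : (Fin d → ℝ) → ℝ :=
  if h : ∃ g, IsWeakDeriv I f g then h.choose else 0

/-- The inner product `⟨D^k f, D^k g⟩_{L²}` of `H^k_0`, where `D^k f` is the tensor of all `k`-th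
order partial derivatives. -/
def sobolevInner (k : ℕ) {d : ℕ} (f g : (Fin d → ℝ) → ℝ) : ℝ :=
  ∑ I : Fin k → Fin d, ∫ x, weakDeriv I f x * weakDeriv I g x ∂(torusMeasure d)

/-- The homogeneous Sobolev norm `‖D^k f‖_{L²}`. -/
def sobolevNorm (k : ℕ) {d : ℕ} (f : (Fin d → ℝ) → ℝ) : ℝ :=
  Real.sqrt (sobolevInner k f f)

/-! ### The grid and the sampling operator

The grid with `n = N ^ d` points is indexed by `Fin d → Fin N`. -/

/-- The grid point `(τ_1 / N, …, τ_d / N)`. -/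
def gridPoint {d N : ℕ} (τ : Fin d → Fin N) : Fin d → ℝ :=
  fun i => ((τ i : ℕ) : ℝ) / (N : ℝ)

/-- The sampling operator. -/
def sample {d : ℕ} (N : ℕ) (f : (Fin d → ℝ) → ℝ) : (Fin d → Fin N) → ℝ :=
  fun τ => f (gridPoint τ)

/-! ### Systems of cubes and the multiresolution norm -/

/-- `B` is a cube `∏ [a_i, a_i + h)` contained in `[0,1]^d`, with `0 < h ≤ 1`. -/
def IsCube {d : ℕ} (B : Set (Fin d → ℝ)) : Prop :=
  ∃ (a : Fin d → ℝ) (h : ℝ), 0 < h ∧ h ≤ 1 ∧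
    B = Set.univ.pi (fun i => Set.Ico (a i) (a i + h)) ∧ B ⊆ Set.Icc 0 1

/-- `𝓑` is a normal system of cubes with normality constant `c`. -/
def IsNormalSystem {d : ℕ} (c : ℝ) (𝓑 : Set (Set (Fin d → ℝ))) : Prop :=
  1 < c ∧ (∀ B ∈ 𝓑, IsCube B) ∧
    ∀ B : Set (Fin d → ℝ), IsCube B →
      ∃ B' ∈ 𝓑, B' ⊆ B ∧ volume.real B / c ≤ volume.real B'

open Classical in
/-- The indices of the grid points lying in `B`. -/
def gridIn {d : ℕ} (N : ℕ) (B : Set (Fin d → ℝ)) : Finset (Fin d → Fin N) :=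
  Finset.univ.filter (fun τ => gridPoint τ ∈ B)

/-- The multiresolution norm `‖y‖_𝓑`. A cube without grid points contributes `0 / √0 = 0`. -/
def multiresNorm {d N : ℕ} (𝓑 : Set (Set (Fin d → ℝ))) (y : (Fin d → Fin N) → ℝ) : ℝ :=
  ⨆ B : 𝓑, |∑ τ ∈ gridIn N (B : Set (Fin d → ℝ)), y τ| /
    Real.sqrt ((gridIn N (B : Set (Fin d → ℝ))).card : ℝ)

/-- The dual multiresolution norm `‖ω‖_{𝓑*}`, with values in `[0,∞]`; it is finite for every `ω` as
soon as `‖·‖_𝓑` is a norm. (The supremum is over a set symmetric about `0`, so nothing is lost by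
`ENNReal.ofReal`.) -/
def dualMultiresNorm {d N : ℕ} (𝓑 : Set (Set (Fin d → ℝ))) (ω : (Fin d → Fin N) → ℝ) : ℝ≥0∞ :=
  ⨆ (v : (Fin d → Fin N) → ℝ) (_ : multiresNorm 𝓑 v ≤ 1), ENNReal.ofReal (∑ τ, ω τ * v τ)

/-! ### The estimator and the distance function -/

/-- `f'` is a MIND estimator: it minimizes `½ ‖D^k g‖²` over all `g ∈ H^k_0` satisfying the
constraint `‖S_n g - y‖_𝓑 ≤ γ`. -/
def IsMINDEstimator (k : ℕ) {d N : ℕ} (𝓑 : Set (Set (Fin d → ℝ))) (y : (Fin d → Fin N) → ℝ)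
    (γ : ℝ) (f' : (Fin d → ℝ) → ℝ) : Prop :=
  (f' ∈ SobolevZero k d ∧ multiresNorm 𝓑 (sample N f' - y) ≤ γ) ∧
    ∀ g ∈ SobolevZero k d, multiresNorm 𝓑 (sample N g - y) ≤ γ →
      1 / 2 * sobolevNorm k f' ^ 2 ≤ 1 / 2 * sobolevNorm k g ^ 2

/-- `w = S_n^* ω`, for the adjoint of the sampling operator on `H^k_0` (`k > d/2`): `w` is the unique
element of `H^k_0` with `∑_x u(x) ω(x) = ⟨u, w⟩_{H^k_0}` for all `u ∈ H^k_0`. -/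
def IsAdjointSample (k : ℕ) {d N : ℕ} (ω : (Fin d → Fin N) → ℝ) (w : (Fin d → ℝ) → ℝ) : Prop :=
  w ∈ SobolevZero k d ∧
    ∀ u ∈ SobolevZero k d, ∑ τ, sample N u τ * ω τ = sobolevInner k u w

/-- The multiscale distance function `d_n(t)` of `f`, `n = N ^ d`: the minimum of
`‖D^k S_n^* ω - D^k f‖_{L²}` over all `ω` with `‖ω‖_{𝓑*} ≤ t`. -/
def distFun (k : ℕ) {d : ℕ} (N : ℕ) (𝓑 : Set (Set (Fin d → ℝ))) (f : (Fin d → ℝ) → ℝ)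
    (t : ℝ≥0) : ℝ :=
  sInf {r : ℝ | ∃ (ω : (Fin d → Fin N) → ℝ) (w : (Fin d → ℝ) → ℝ),
    dualMultiresNorm 𝓑 ω ≤ (t : ℝ≥0∞) ∧ IsAdjointSample k ω w ∧ r = sobolevNorm k (w - f)}

/-- `c_n = min_{t ≥ 0} (d_n(t) + (γ t)^{1/2})`, `n = N ^ d`. -/
def cMin (k : ℕ) {d : ℕ} (N : ℕ) (𝓑 : Set (Set (Fin d → ℝ))) (f : (Fin d → ℝ) → ℝ)
    (γ : ℝ) : ℝ :=
  ⨅ t : ℝ≥0, (distFun k N 𝓑 f t + Real.sqrt (γ * t))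

open Classical in
/-- The exponent `ϑ(k, d, q)`; for `q = ∞` the term `d / q` is `0`. -/
def theta (k d : ℕ) (q : ℝ≥0∞) : ℝ :=
  if q ≤ ENNReal.ofReal ((4 * k + 2 * d) / d) then (k : ℝ) / (2 * k + d)
  else (k - d / 2 + d * (q⁻¹).toReal) / (2 * k)

/-- The exponent `ϑ' = 2 k ϑ / d`. -/
def theta' (k d : ℕ) (q : ℝ≥0∞) : ℝ :=
  2 * k * theta k d q / d

end MIND

end

/-!
Let `u = f' - f`. Feasibility of `f` and `f'` gives `‖S_n u‖_𝓑 ≤ 2γ`, and `‖D^k f'‖ ≤ ‖D^k f‖`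
together with the duality `-⟨u, S_n^* ω⟩ = -∑ u ω ≤ 2γ ‖ω‖_{𝓑*}` gives `‖D^k u‖ ≤ 3 c_n`. The rate
is then an interpolation inequality between these two bounds.

On a cube `Q` of side length `h ≥ C₀ / N`, the function `u` is uniformly close to an average of its
Taylor polynomials of degree less than `k`. Polynomials of bounded degree form a finite-dimensional
space, so such a polynomial stays near its maximum on a smaller cube of comparable size. A normal
system contains a cube inside that one, with at least a constant times `(h N)^d` grid points, whence
`sup_Q |u| ≤ K (b h^{-d/2} + h^k (⨍_Q |D^k u|^r)^{1/r})` for `b = γ / √n` and some `r < 2`.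
Balancing the two terms at a single scale `h` bounds `u` uniformly. At the critical exponent
`q = (4k + 2d) / d`, one uses at each point the coarsest dyadic scale at which the first term
dominates up to a constant, and sums Chebyshev's inequality over the scales; `r < 2` makes that sum
controlled by `∫ |D^k u|²`. The remaining `q` follow from these two cases, and trigonometric
polynomials reduce Sobolev functions to smooth ones.
-/

noncomputable section

namespace MIND

/-! ### Fourier series of periodic functions -/

section Fourier

attribute [local instance] instMeasureSpaceUnitAddCircle

lemma isProbabilityMeasure_unitAddCircle :
    IsProbabilityMeasure (volume : Measure UnitAddCircle) :=
  inferInstanceAs (IsProbabilityMeasure AddCircle.haarAddCircle)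

attribute [local instance] isProbabilityMeasure_unitAddCircle

variable {d : ℕ}

instance isProbabilityMeasure_torusMeasure (d : ℕ) : IsProbabilityMeasure (torusMeasure d) :=
  ⟨by simp [torusMeasure, Real.volume_Icc_pi]⟩

/-- The measurable section `UnitAddTorus → (0,1]^d` of the covering map. It transports the Fourier
theory of `UnitAddTorus` to periodic functions on `ℝ^d`. -/
def torusSection (d : ℕ) (t : UnitAddTorus (Fin d)) : Fin d → ℝ :=
  (UnitAddTorus.measurableEquivPiIoc (0 : Fin d → ℝ) t).1

lemma coe_torusSection (t : UnitAddTorus (Fin d)) :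
    (fun i => ((torusSection d t i : ℝ) : UnitAddCircle)) = t :=
  (UnitAddTorus.measurableEquivPiIoc (0 : Fin d → ℝ)).symm_apply_apply t

lemma IsPeriodic.apply_torusSection {f : (Fin d → ℝ) → ℝ} (hf : IsPeriodic f) (x : Fin d → ℝ) :
    f (torusSection d fun i => (x i : UnitAddCircle)) = f x := by
  have integer_shift (i : Fin d) :
      ∃ z : ℤ, x i + z = torusSection d (fun i => (x i : UnitAddCircle)) i := by
    have h := congrFun (coe_torusSection fun i => (x i : UnitAddCircle)) i
    rw [← sub_eq_zero, ← AddCircle.coe_sub, AddCircle.coe_eq_zero_iff] at h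
    obtain ⟨z, hz⟩ := h
    rw [zsmul_one] at hz
    exact ⟨z, by linarith⟩
  choose z hz using integer_shift
  rw [← hf x z, ← funext hz]

lemma measurableSet_pi_Ioc (d : ℕ) :
    MeasurableSet
      {x : Fin d → ℝ | ∀ i, x i ∈ Set.Ioc ((0 : Fin d → ℝ) i) ((0 : Fin d → ℝ) i + 1)} :=
  MeasurableSet.univ_pi' fun _ => measurableSet_Ioc

lemma measurableEmbedding_torusSection (d : ℕ) : MeasurableEmbedding (torusSection d) :=
  (MeasurableEmbedding.subtype_coe (measurableSet_pi_Ioc d)).comp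
    (UnitAddTorus.measurableEquivPiIoc (0 : Fin d → ℝ)).measurableEmbedding

lemma measurePreserving_torusSection (d : ℕ) :
    MeasurePreserving (torusSection d) volume (torusMeasure d) := by
  refine MeasurePreserving.comp ⟨measurable_subtype_coe, ?_⟩
    (UnitAddTorus.measurePreserving_equivPiIoc (0 : Fin d → ℝ))
  refine (map_comap_subtype_coe (measurableSet_pi_Ioc d) _).trans ?_
  have pi_Ioc : {x : Fin d → ℝ | ∀ i, x i ∈ Set.Ioc ((0 : Fin d → ℝ) i) ((0 : Fin d → ℝ) i + 1)}
      = Set.univ.pi fun i => Set.Ioc ((0 : Fin d → ℝ) i) ((1 : Fin d → ℝ) i) := by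
    ext x
    simp
  rw [pi_Ioc]
  exact Measure.restrict_congr_set (Measure.univ_pi_Ioc_ae_eq_Icc
    (μ := fun _ : Fin d => (volume : Measure ℝ)) (f := 0) (g := 1))

/-- The phase `x ↦ 2π ξ · x` of the character of frequency `ξ`. -/
def phase (ξ : Fin d → ℤ) : (Fin d → ℝ) →L[ℝ] ℝ :=
  (2 * Real.pi) • ∑ i, (ξ i : ℝ) • ContinuousLinearMap.proj i

lemma phase_apply (ξ : Fin d → ℤ) (x : Fin d → ℝ) :
    phase ξ x = 2 * Real.pi * ∑ i, (ξ i : ℝ) * x i := by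
  simp [phase]

/-- The character `exp (2π i ξ · x)` of the torus, as a function on `ℝ^d`. -/
def expo (ξ : Fin d → ℤ) (x : Fin d → ℝ) : ℂ := Complex.exp (phase ξ x * Complex.I)

lemma continuous_expo (ξ : Fin d → ℤ) : Continuous (expo ξ) := by
  unfold expo
  fun_prop

lemma norm_expo (ξ : Fin d → ℤ) (x : Fin d → ℝ) : ‖expo ξ x‖ = 1 :=
  Complex.norm_exp_ofReal_mul_I _

lemma mFourier_coe (ξ : Fin d → ℤ) (x : Fin d → ℝ) :
    UnitAddTorus.mFourier ξ (fun i => (x i : UnitAddCircle)) = expo ξ x := by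
  simp only [UnitAddTorus.mFourier, ContinuousMap.coe_mk, fourier_coe_apply, expo, phase_apply]
  rw [← Complex.exp_sum]
  push_cast
  rw [Finset.mul_sum, Finset.sum_mul]
  congr 1
  exact Finset.sum_congr rfl fun i _ => by ring

lemma mFourier_eq_expo_torusSection (ξ : Fin d → ℤ) (t : UnitAddTorus (Fin d)) :
    UnitAddTorus.mFourier ξ t = expo ξ (torusSection d t) := by
  rw [← mFourier_coe, coe_torusSection]

/-- The Fourier coefficients of a function on the torus. -/
def fourierCoef (f : (Fin d → ℝ) → ℝ) (ξ : Fin d → ℤ) : ℂ :=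
  ∫ x, expo (-ξ) x * (f x : ℂ) ∂(torusMeasure d)

lemma mFourierCoeff_comp_torusSection (f : (Fin d → ℝ) → ℝ) (ξ : Fin d → ℤ) :
    UnitAddTorus.mFourierCoeff (fun t => (f (torusSection d t) : ℂ)) ξ = fourierCoef f ξ := by
  unfold UnitAddTorus.mFourierCoeff fourierCoef
  rw [← (measurePreserving_torusSection d).integral_comp (measurableEmbedding_torusSection d)]
  simp only [mFourier_eq_expo_torusSection, smul_eq_mul]

lemma memLp_comp_torusSection {f : (Fin d → ℝ) → ℝ} (hf : MemLp f 2 (torusMeasure d)) :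
    MemLp (fun t => (f (torusSection d t) : ℂ)) 2 volume :=
  (hf.comp_measurePreserving (measurePreserving_torusSection d)).ofReal

lemma hasSum_sq_fourierCoef {f : (Fin d → ℝ) → ℝ} (hf : MemLp f 2 (torusMeasure d)) :
    HasSum (fun ξ => ‖fourierCoef f ξ‖ ^ 2) (∫ x, f x ^ 2 ∂(torusMeasure d)) := by
  have hF := memLp_comp_torusSection hf
  have coeff_eq : ∀ ξ, UnitAddTorus.mFourierCoeff hF.toLp ξ = fourierCoef f ξ := fun ξ => by
    rw [← mFourierCoeff_comp_torusSection]
    exact integral_congr_ae (ae_eq_rfl.mul hF.coeFn_toLp)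
  have parseval := UnitAddTorus.hasSum_sq_mFourierCoeff hF.toLp
  simp only [coeff_eq] at parseval
  convert parseval using 1
  rw [← (measurePreserving_torusSection d).integral_comp (measurableEmbedding_torusSection d)]
  refine integral_congr_ae ?_
  filter_upwards [hF.coeFn_toLp] with t ht
  simp [ht]

lemma ae_eq_zero_of_fourierCoef_eq_zero {f : (Fin d → ℝ) → ℝ} (hf : MemLp f 2 (torusMeasure d))
    (h : ∀ ξ, fourierCoef f ξ = 0) : f =ᵐ[torusMeasure d] 0 := by
  have hsum := hasSum_sq_fourierCoef hf
  simp only [h, norm_zero, ne_eq, OfNat.ofNat_ne_zero, not_false_eq_true, zero_pow] at hsum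
  have hzero := hsum.unique hasSum_zero
  rw [integral_eq_zero_iff_of_nonneg (fun x => sq_nonneg (f x)) hf.integrable_sq] at hzero
  filter_upwards [hzero] with x hx
  simpa using hx

lemma integral_norm_sq_sum_expo (F : Finset (Fin d → ℤ)) (a : (Fin d → ℤ) → ℂ) :
    ∫ x, ‖∑ ξ ∈ F, a ξ * expo ξ x‖ ^ 2 ∂(torusMeasure d) = ∑ ξ ∈ F, ‖a ξ‖ ^ 2 := by
  have parseval := (UnitAddTorus.orthonormal_mFourier (d := Fin d)).inner_sum a a F
  have sum_toLp : ∑ ξ ∈ F, a ξ • UnitAddTorus.mFourierLp 2 ξ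
      = ContinuousMap.toLp (E := ℂ) 2 volume ℂ (∑ ξ ∈ F, a ξ • UnitAddTorus.mFourier ξ) := by
    simp [map_sum]
  rw [sum_toLp, ContinuousMap.inner_toLp] at parseval
  rw [← (measurePreserving_torusSection d).integral_comp (measurableEmbedding_torusSection d)]
  apply Complex.ofReal_injective
  rw [← integral_complex_ofReal]
  simp only [Complex.conj_mul', ← mul_comm (starRingEnd ℂ _)] at parseval
  push_cast
  rw [← parseval]
  refine integral_congr_ae (Filter.Eventually.of_forall fun t => ?_)
  simp [ContinuousMap.sum_apply, mFourier_eq_expo_torusSection]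

lemma isOpenQuotientMap_coe_torus (d : ℕ) :
    IsOpenQuotientMap (fun (x : Fin d → ℝ) (i : Fin d) => (x i : UnitAddCircle)) :=
  IsOpenQuotientMap.piMap fun _ => QuotientAddGroup.isOpenQuotientMap_mk

lemma IsPeriodic.continuous_comp_torusSection {f : (Fin d → ℝ) → ℝ} (hp : IsPeriodic f)
    (hf : Continuous f) : Continuous (f ∘ torusSection d) := by
  rw [(isOpenQuotientMap_coe_torus d).isQuotientMap.continuous_iff]
  exact hf.congr fun x => (hp.apply_torusSection x).symm

lemma IsPeriodic.hasSum_fourierCoef {f : (Fin d → ℝ) → ℝ} (hp : IsPeriodic f) (hf : Continuous f)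
    (hs : Summable (fourierCoef f)) (x : Fin d → ℝ) :
    HasSum (fun ξ => fourierCoef f ξ * expo ξ x) (f x : ℂ) := by
  let F : C(UnitAddTorus (Fin d), ℂ) :=
    ⟨fun t => (f (torusSection d t) : ℂ),
      Complex.continuous_ofReal.comp (hp.continuous_comp_torusSection hf)⟩
  have coeff_eq : UnitAddTorus.mFourierCoeff F = fourierCoef f :=
    funext fun ξ => mFourierCoeff_comp_torusSection f ξ
  have hsum := UnitAddTorus.hasSum_mFourier_series_apply_of_summable (f := F) (coeff_eq ▸ hs)
    (fun i => (x i : UnitAddCircle))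
  rw [coeff_eq] at hsum
  simpa [mFourier_coe, F, hp.apply_torusSection] using hsum

end Fourier

/-! ### Weak derivatives -/

section WeakDerivatives

variable {d m : ℕ}

lemma contDiff_expo (ξ : Fin d → ℤ) {n : WithTop ℕ∞} : ContDiff ℝ n (expo ξ) :=
  ((Complex.ofRealCLM.contDiff.comp (phase ξ).contDiff).mul contDiff_const).cexp

lemma hasFDerivAt_expo (ξ : Fin d → ℤ) (x : Fin d → ℝ) :
    HasFDerivAt (expo ξ)
      (expo ξ x • (Complex.ofRealCLM.comp (phase ξ)).smulRight Complex.I) x :=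
  ((Complex.ofRealCLM.comp (phase ξ)).smulRight Complex.I).hasFDerivAt.cexp

lemma iteratedFDeriv_expo (ξ : Fin d → ℤ) (m : ℕ) (x : Fin d → ℝ) (h : Fin m → Fin d → ℝ) :
    iteratedFDeriv ℝ m (expo ξ) x h = (∏ j, (phase ξ (h j) : ℂ) * Complex.I) * expo ξ x := by
  induction m generalizing x with
  | zero => simp
  | succ n ih =>
    have hdiff : DifferentiableAt ℝ (iteratedFDeriv ℝ n (expo ξ)) x :=
      ((contDiff_expo ξ (n := ⊤)).differentiable_iteratedFDeriv
        (by exact_mod_cast WithTop.coe_lt_top _)).differentiableAt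
    rw [iteratedFDeriv_succ_apply_left, ← fderiv_continuousMultilinear_apply_const_apply hdiff]
    simp only [ih, ((hasFDerivAt_expo ξ x).const_mul _).fderiv]
    simp only [smul_apply, ContinuousLinearMap.smulRight_apply,
      ContinuousLinearMap.comp_apply, Complex.ofRealCLM_apply, smul_eq_mul, Fin.prod_univ_succ,
      Fin.tail]
    ring

/-- The Fourier symbol `∏ j, 2πi ξ_{I j}` of `∂_{I 0} ⋯ ∂_{I (m-1)}`. -/
def symbol (I : Fin m → Fin d) (ξ : Fin d → ℤ) : ℂ :=
  ∏ j, ((2 * Real.pi * ξ (I j) : ℝ) : ℂ) * Complex.I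

lemma symbol_neg (I : Fin m → Fin d) (ξ : Fin d → ℤ) :
    symbol I (-ξ) = (-1) ^ m * symbol I ξ := by
  simp only [symbol, ← Fin.prod_const, ← Finset.prod_mul_distrib]
  refine Finset.prod_congr rfl fun j _ => ?_
  simp

lemma iteratedFDeriv_expo_single (ξ : Fin d → ℤ) (I : Fin m → Fin d) (x : Fin d → ℝ) :
    iteratedFDeriv ℝ m (expo ξ) x (fun j => Pi.single (I j) (1 : ℝ)) = symbol I ξ * expo ξ x := by
  rw [iteratedFDeriv_expo]
  simp [symbol, phase_apply, Pi.single_apply]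

lemma partialDeriv_clm_expo (T : ℂ →L[ℝ] ℝ) (ξ : Fin d → ℤ) (I : Fin m → Fin d) (x : Fin d → ℝ) :
    partialDeriv I (fun x => T (expo ξ x)) x = T (symbol I ξ * expo ξ x) := by
  have h := T.iteratedFDeriv_comp_left (x := x) (i := m) (contDiff_expo ξ).contDiffAt le_rfl
  rw [← iteratedFDeriv_expo_single]
  exact congrArg (fun L => L fun j => Pi.single (I j) (1 : ℝ)) h

lemma expo_add_intCast (ξ : Fin d → ℤ) (x : Fin d → ℝ) (z : Fin d → ℤ) :
    expo ξ (fun i => x i + (z i : ℝ)) = expo ξ x := by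
  rw [← mFourier_coe, ← mFourier_coe]
  congr 1
  ext i
  simp

lemma memLp_torusMeasure_of_continuous {f : (Fin d → ℝ) → ℝ} (hf : Continuous f) (p : ℝ≥0∞) :
    MemLp f p (torusMeasure d) := by
  obtain ⟨B, hB⟩ := (isCompact_Icc (a := (0 : Fin d → ℝ)) (b := 1)).exists_bound_of_continuousOn
    hf.continuousOn
  exact MemLp.of_bound hf.aestronglyMeasurable B
    ((ae_restrict_iff' measurableSet_Icc).2 (Filter.Eventually.of_forall hB))

lemma integrable_expo_mul {f : (Fin d → ℝ) → ℝ} (hf : MemLp f 2 (torusMeasure d))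
    (ξ : Fin d → ℤ) : Integrable (fun x => expo ξ x * (f x : ℂ)) (torusMeasure d) :=
  (hf.integrable (by norm_num)).ofReal.bdd_mul (c := 1) (continuous_expo ξ).aestronglyMeasurable
    (Filter.Eventually.of_forall fun x => (norm_expo ξ x).le)

lemma IsWeakDeriv.integral_symbol_mul_expo {I : Fin m → Fin d} {f g : (Fin d → ℝ) → ℝ}
    (h : IsWeakDeriv I f g) (hf : MemLp f 2 (torusMeasure d)) (ξ : Fin d → ℤ) :
    ∫ x, symbol I ξ * (expo ξ x * (f x : ℂ)) ∂torusMeasure d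
      = (-1) ^ m * ∫ x, expo ξ x * (g x : ℂ) ∂torusMeasure d := by
  have real_part : ∀ T : ℂ →L[ℝ] ℝ,
      T (∫ x, symbol I ξ * (expo ξ x * (f x : ℂ)) ∂torusMeasure d)
        = T ((-1) ^ m * ∫ x, expo ξ x * (g x : ℂ) ∂torusMeasure d) := by
    intro T
    have T_mul_real : ∀ (z : ℂ) (r : ℝ), T (z * (r : ℂ)) = r * T z := fun z r => by
      rw [mul_comm, ← Complex.real_smul, T.map_smul, smul_eq_mul]
    have tested := h.2 (fun x => T (expo ξ x)) (T.contDiff.comp (contDiff_expo ξ))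
      (fun x z => by simp only [expo_add_intCast])
    simp only [partialDeriv_clm_expo, ← T_mul_real] at tested
    have sign : (-1 : ℂ) ^ m = (((-1) ^ m : ℝ) : ℂ) := by push_cast; rfl
    rw [← ContinuousLinearMap.integral_comp_comm _ ((integrable_expo_mul hf _).const_mul _),
      sign, mul_comm _ (∫ x, _ ∂_), T_mul_real,
      ← ContinuousLinearMap.integral_comp_comm _ (integrable_expo_mul h.1 _)]
    simpa only [← mul_assoc] using tested
  exact Complex.ext (real_part Complex.reCLM) (real_part Complex.imCLM)

lemma IsWeakDeriv.fourierCoef_eq {I : Fin m → Fin d} {f g : (Fin d → ℝ) → ℝ}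
    (h : IsWeakDeriv I f g) (hf : MemLp f 2 (torusMeasure d)) (ξ : Fin d → ℤ) :
    fourierCoef g ξ = symbol I ξ * fourierCoef f ξ := by
  have tested := h.integral_symbol_mul_expo hf (-ξ)
  rw [integral_const_mul, symbol_neg, mul_assoc] at tested
  exact (mul_left_cancel₀ (pow_ne_zero _ (by norm_num)) tested).symm

lemma fourierCoef_sub {f g : (Fin d → ℝ) → ℝ} (hf : MemLp f 2 (torusMeasure d))
    (hg : MemLp g 2 (torusMeasure d)) (ξ : Fin d → ℤ) :
    fourierCoef (f - g) ξ = fourierCoef f ξ - fourierCoef g ξ := by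
  unfold fourierCoef
  rw [← integral_sub (integrable_expo_mul hf _) (integrable_expo_mul hg _)]
  simp [mul_sub]

lemma IsWeakDeriv.ae_unique {I : Fin m → Fin d} {f g g' : (Fin d → ℝ) → ℝ}
    (h : IsWeakDeriv I f g) (h' : IsWeakDeriv I f g') (hf : MemLp f 2 (torusMeasure d)) :
    g =ᵐ[torusMeasure d] g' := by
  have hzero := ae_eq_zero_of_fourierCoef_eq_zero (h.1.sub h'.1) fun ξ => by
    rw [fourierCoef_sub h.1 h'.1, h.fourierCoef_eq hf, h'.fourierCoef_eq hf, sub_self]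
  filter_upwards [hzero] with x hx
  simpa [sub_eq_zero] using hx

lemma isWeakDeriv_weakDeriv {I : Fin m → Fin d} {f : (Fin d → ℝ) → ℝ}
    (h : ∃ g, IsWeakDeriv I f g) : IsWeakDeriv I f (weakDeriv I f) := by
  unfold weakDeriv
  rw [dif_pos h]
  exact h.choose_spec

lemma isWeakDeriv_zero (I : Fin m → Fin d) : IsWeakDeriv I (0 : (Fin d → ℝ) → ℝ) 0 :=
  ⟨MemLp.zero, by simp⟩

lemma continuous_partialDeriv {v : (Fin d → ℝ) → ℝ} (hv : ContDiff ℝ m v) (I : Fin m → Fin d) :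
    Continuous (partialDeriv I v) := by
  have := hv.continuous_iteratedFDeriv (m := m) le_rfl
  unfold partialDeriv
  fun_prop

lemma IsWeakDeriv.sub {I : Fin m → Fin d} {f f' g g' : (Fin d → ℝ) → ℝ}
    (h : IsWeakDeriv I f g) (h' : IsWeakDeriv I f' g') (hf : MemLp f 2 (torusMeasure d))
    (hf' : MemLp f' 2 (torusMeasure d)) : IsWeakDeriv I (f - f') (g - g') := by
  refine ⟨h.1.sub h'.1, fun φ hφ hp => ?_⟩
  have hφI : Continuous (partialDeriv I φ) :=
    continuous_partialDeriv (hφ.of_le (by exact_mod_cast le_top)) I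
  have integrable_mul : ∀ u v : (Fin d → ℝ) → ℝ, MemLp u 2 (torusMeasure d) → Continuous v →
      Integrable (fun x => u x * v x) (torusMeasure d) := fun u v hu hv =>
    hu.integrable_mul (memLp_torusMeasure_of_continuous hv 2)
  simp only [Pi.sub_apply, sub_mul]
  rw [integral_sub (integrable_mul _ _ hf hφI) (integrable_mul _ _ hf' hφI),
    integral_sub (integrable_mul _ _ h.1 hφ.continuous) (integrable_mul _ _ h'.1 hφ.continuous),
    h.2 φ hφ hp, h'.2 φ hφ hp]
  ring

end WeakDerivatives

namespace SobolevZero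

variable {k d : ℕ} {f g : (Fin d → ℝ) → ℝ}

lemma memLp (hf : f ∈ SobolevZero k d) : MemLp f 2 (torusMeasure d) :=
  memLp_torusMeasure_of_continuous hf.1 2

lemma isWeakDeriv (hf : f ∈ SobolevZero k d) (I : Fin k → Fin d) :
    IsWeakDeriv I f (weakDeriv I f) :=
  isWeakDeriv_weakDeriv (hf.2.2.2 k le_rfl I)

lemma fourierCoef_weakDeriv (hf : f ∈ SobolevZero k d) (I : Fin k → Fin d) (ξ : Fin d → ℤ) :
    fourierCoef (weakDeriv I f) ξ = symbol I ξ * fourierCoef f ξ :=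
  (isWeakDeriv hf I).fourierCoef_eq (memLp hf) ξ

lemma zero_mem (k d : ℕ) : (0 : (Fin d → ℝ) → ℝ) ∈ SobolevZero k d :=
  ⟨continuous_const, fun _ _ => rfl, by simp, fun _ _ I => ⟨0, isWeakDeriv_zero I⟩⟩

lemma sub_mem (hf : f ∈ SobolevZero k d) (hg : g ∈ SobolevZero k d) : f - g ∈ SobolevZero k d := by
  refine ⟨hf.1.sub hg.1, fun x z => ?_, ?_, fun m hm I => ?_⟩
  · simp only [Pi.sub_apply, hf.2.1 x z, hg.2.1 x z]
  · simp only [Pi.sub_apply]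
    rw [integral_sub ((memLp hf).integrable (by norm_num)) ((memLp hg).integrable (by norm_num)),
      hf.2.2.1, hg.2.2.1, sub_zero]
  · obtain ⟨F, hF⟩ := hf.2.2.2 m hm I
    obtain ⟨G, hG⟩ := hg.2.2.2 m hm I
    exact ⟨F - G, hF.sub hG (memLp hf) (memLp hg)⟩

lemma weakDeriv_sub (hf : f ∈ SobolevZero k d) (hg : g ∈ SobolevZero k d) (I : Fin k → Fin d) :
    weakDeriv I (f - g) =ᵐ[torusMeasure d] weakDeriv I f - weakDeriv I g :=
  (isWeakDeriv (sub_mem hf hg) I).ae_unique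
    ((isWeakDeriv hf I).sub (isWeakDeriv hg I) (memLp hf) (memLp hg)) (memLp (sub_mem hf hg))

end SobolevZero

/-! ### Uniform approximation by trigonometric polynomials -/

section TrigonometricApproximation

variable {k d m : ℕ}

open Submodule in
lemma summable_inv_norm_pow (h : d < m) : Summable fun ξ : Fin d → ℤ => (‖ξ‖ : ℝ)⁻¹ ^ m := by
  let L := span ℤ (Set.range (Pi.basisFun ℝ (Fin d)))
  have rank_L : Module.finrank ℤ L = d := by simpa using ZLattice.rank ℝ L
  have mem_L (ξ : Fin d → ℤ) : (fun i => (ξ i : ℝ)) ∈ L := by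
    have : (fun i => (ξ i : ℝ)) = ∑ i, ξ i • Pi.basisFun ℝ (Fin d) i := by
      ext j
      simp [Pi.single_apply]
    rw [this]
    exact sum_mem fun i _ => smul_mem _ _ (subset_span ⟨i, rfl⟩)
  refine (ZLattice.summable_norm_pow_inv L m (rank_L.trans_lt h)).comp_injective
    (i := fun ξ : Fin d → ℤ => (⟨fun i => (ξ i : ℝ), mem_L ξ⟩ : L)) fun a b hab => ?_
  ext i
  simpa using congrFun (congrArg Subtype.val hab) i

lemma exists_norm_eq_abs_apply {ξ : Fin d → ℤ} (h : ξ ≠ 0) : ∃ i, ‖ξ‖ = |(ξ i : ℝ)| := by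
  have : Nonempty (Fin d) := (Function.ne_iff.1 h).nonempty
  obtain ⟨i, -, hi⟩ := Finset.exists_mem_eq_sup Finset.univ Finset.univ_nonempty (fun i => ‖ξ i‖₊)
  exact ⟨i, by rw [Pi.norm_def, hi]; simp [Int.norm_eq_abs]⟩

lemma norm_pow_le_norm_symbol_const {ξ : Fin d → ℤ} {i : Fin d} (hi : ‖ξ‖ = |(ξ i : ℝ)|) :
    ‖ξ‖ ^ k ≤ ‖symbol (fun _ : Fin k => i) ξ‖ := by
  simp only [symbol, norm_mul, Complex.norm_I, mul_one, Complex.norm_real, norm_pow,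
    Finset.prod_const, Finset.card_univ, Fintype.card_fin, Real.norm_eq_abs, ← hi]
  gcongr
  rw [abs_two, abs_of_pos Real.pi_pos]
  nlinarith [Real.pi_gt_three, norm_nonneg ξ]

lemma fourierCoef_zero_of_mem_sobolevZero {f : (Fin d → ℝ) → ℝ} (hf : f ∈ SobolevZero k d) :
    fourierCoef f 0 = 0 := by
  have expo_zero (x : Fin d → ℝ) : expo (-(0 : Fin d → ℤ)) x = 1 := by simp [expo, phase_apply]
  simp only [fourierCoef, expo_zero, one_mul]
  rw [integral_complex_ofReal, hf.2.2.1, Complex.ofReal_zero]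

lemma summable_fourierCoef (hk : d < 2 * k) {f : (Fin d → ℝ) → ℝ} (hf : f ∈ SobolevZero k d) :
    Summable (fourierCoef f) := by
  let pure (i : Fin d) (ξ : Fin d → ℤ) : ℝ := ‖fourierCoef (weakDeriv (fun _ : Fin k => i) f) ξ‖
  have summable_pure : Summable fun ξ => ∑ i, pure i ξ ^ 2 :=
    summable_sum fun i _ => (hasSum_sq_fourierCoef (SobolevZero.isWeakDeriv hf _).1).summable
  refine Summable.of_norm_bounded ((summable_inv_norm_pow hk).add summable_pure) fun ξ => ?_
  rcases eq_or_ne ξ 0 with rfl | hξ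
  · rw [fourierCoef_zero_of_mem_sobolevZero hf, norm_zero]
    positivity
  obtain ⟨i, hi⟩ := exists_norm_eq_abs_apply hξ
  have coef_le : ‖fourierCoef f ξ‖ ≤ ‖ξ‖⁻¹ ^ k * pure i ξ := by
    rw [inv_pow, ← div_eq_inv_mul, le_div_iff₀' (pow_pos (norm_pos_iff.2 hξ) k)]
    simp only [pure, SobolevZero.fourierCoef_weakDeriv hf, norm_mul]
    gcongr
    exact norm_pow_le_norm_symbol_const hi
  have pure_le : pure i ξ ^ 2 ≤ ∑ i, pure i ξ ^ 2 :=
    Finset.single_le_sum (f := fun i => pure i ξ ^ 2) (fun _ _ => by positivity)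
      (Finset.mem_univ i)
  calc ‖fourierCoef f ξ‖ ≤ ‖ξ‖⁻¹ ^ k * pure i ξ := coef_le
    _ ≤ (‖ξ‖⁻¹ ^ k) ^ 2 + pure i ξ ^ 2 := by
      nlinarith [two_mul_le_add_sq (‖ξ‖⁻¹ ^ k) (pure i ξ), sq_nonneg (‖ξ‖⁻¹ ^ k),
        sq_nonneg (pure i ξ)]
    _ ≤ ‖ξ‖⁻¹ ^ (2 * k) + ∑ i, pure i ξ ^ 2 := by
      rw [← pow_mul, mul_comm k]
      gcongr

/-- The real part of the trigonometric polynomial with frequencies `F` and coefficients `a`. -/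
def trigPoly (F : Finset (Fin d → ℤ)) (a : (Fin d → ℤ) → ℂ) (x : Fin d → ℝ) : ℝ :=
  (∑ ξ ∈ F, a ξ * expo ξ x).re

/-- The sum of the absolute values of the partial derivatives of order `m`, one for each of the
`d ^ m` multi-indices. -/
def derivSum (m : ℕ) (v : (Fin d → ℝ) → ℝ) (x : Fin d → ℝ) : ℝ :=
  ∑ I : Fin m → Fin d, |partialDeriv I v x|

lemma derivSum_nonneg (m : ℕ) (v : (Fin d → ℝ) → ℝ) (x : Fin d → ℝ) : 0 ≤ derivSum m v x :=
  Finset.sum_nonneg fun _ _ => abs_nonneg _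

lemma continuous_derivSum {v : (Fin d → ℝ) → ℝ} (hv : ContDiff ℝ m v) :
    Continuous (derivSum m v) :=
  continuous_finsetSum _ fun I _ => (continuous_partialDeriv hv I).abs

lemma contDiff_trigPoly (F : Finset (Fin d → ℤ)) (a : (Fin d → ℤ) → ℂ) {n : WithTop ℕ∞} :
    ContDiff ℝ n (trigPoly F a) :=
  Complex.reCLM.contDiff.comp
    (ContDiff.sum fun ξ _ => contDiff_const.mul (contDiff_expo ξ))

lemma partialDeriv_trigPoly (F : Finset (Fin d → ℤ)) (a : (Fin d → ℤ) → ℂ) (I : Fin m → Fin d) :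
    partialDeriv I (trigPoly F a) = trigPoly F fun ξ => symbol I ξ * a ξ := by
  let T (ξ : Fin d → ℤ) : ℂ →L[ℝ] ℝ := Complex.reCLM.comp (ContinuousLinearMap.mul ℝ ℂ (a ξ))
  have T_apply (ξ : Fin d → ℤ) (z : ℂ) : T ξ z = (a ξ * z).re := rfl
  have trigPoly_eq : trigPoly F a = fun x => ∑ ξ ∈ F, T ξ (expo ξ x) := by
    funext x
    simp only [trigPoly, T_apply, Complex.re_sum]
  funext x
  rw [trigPoly_eq, partialDeriv,
    iteratedFDeriv_fun_sum_apply (f := fun ξ x => T ξ (expo ξ x))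
      fun ξ _ => ((T ξ).contDiff.comp (contDiff_expo ξ)).contDiffAt,
    sum_apply]
  simp only [trigPoly, Complex.re_sum]
  refine Finset.sum_congr rfl fun ξ _ => (partialDeriv_clm_expo (T ξ) ξ I x).trans ?_
  rw [T_apply, ← mul_assoc, mul_comm (a ξ)]

lemma integral_sq_trigPoly_le (F : Finset (Fin d → ℤ)) (a : (Fin d → ℤ) → ℂ) :
    ∫ x, trigPoly F a x ^ 2 ∂torusMeasure d ≤ ∑ ξ ∈ F, ‖a ξ‖ ^ 2 := by
  have := fun ξ : Fin d → ℤ => continuous_expo ξ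
  rw [← integral_norm_sq_sum_expo]
  refine integral_mono
    (memLp_torusMeasure_of_continuous (contDiff_trigPoly F a (n := 0)).continuous 2).integrable_sq
    ((memLp_torusMeasure_of_continuous (by fun_prop) 1).integrable le_rfl) fun x => ?_
  exact sq_le_sq.2 ((Complex.abs_re_le_norm _).trans (le_abs_self _))

lemma sq_derivSum_le (m : ℕ) (v : (Fin d → ℝ) → ℝ) (x : Fin d → ℝ) :
    derivSum m v x ^ 2 ≤ (d : ℝ) ^ m * ∑ I : Fin m → Fin d, partialDeriv I v x ^ 2 := by
  simpa [derivSum] using sq_sum_le_card_mul_sum_sq (s := (Finset.univ : Finset (Fin m → Fin d)))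
    (f := fun I => |partialDeriv I v x|)

lemma integral_sq_derivSum_trigPoly_le {f : (Fin d → ℝ) → ℝ} (hf : f ∈ SobolevZero k d)
    (F : Finset (Fin d → ℤ)) :
    ∫ x, derivSum k (trigPoly F (fourierCoef f)) x ^ 2 ∂torusMeasure d
      ≤ (d : ℝ) ^ k * sobolevInner k f f := by
  set v := trigPoly F (fourierCoef f)
  have hv : ContDiff ℝ k v := contDiff_trigPoly F _
  have integrable_sq {u : (Fin d → ℝ) → ℝ} (hu : Continuous u) :
      Integrable (fun x => u x ^ 2) (torusMeasure d) :=
    (memLp_torusMeasure_of_continuous hu 2).integrable_sq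
  have integral_sq_partialDeriv_le (I : Fin k → Fin d) :
      ∫ x, partialDeriv I v x ^ 2 ∂torusMeasure d
        ≤ ∫ x, weakDeriv I f x * weakDeriv I f x ∂torusMeasure d := by
    have parseval := hasSum_sq_fourierCoef (SobolevZero.isWeakDeriv hf I).1
    simp only [SobolevZero.fourierCoef_weakDeriv hf] at parseval
    rw [partialDeriv_trigPoly]
    simp only [← pow_two]
    exact (integral_sq_trigPoly_le F _).trans
      (sum_le_hasSum _ (fun _ _ => by positivity) parseval)
  calc ∫ x, derivSum k v x ^ 2 ∂torusMeasure d
      ≤ ∫ x, (d : ℝ) ^ k * ∑ I : Fin k → Fin d, partialDeriv I v x ^ 2 ∂torusMeasure d :=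
        integral_mono (integrable_sq (continuous_derivSum hv))
          (.const_mul (integrable_finsetSum _ fun I _ =>
            integrable_sq (continuous_partialDeriv hv I)) _) (sq_derivSum_le k v)
    _ = (d : ℝ) ^ k * ∑ I : Fin k → Fin d, ∫ x, partialDeriv I v x ^ 2 ∂torusMeasure d := by
        rw [integral_const_mul,
          integral_finsetSum _ fun I _ => integrable_sq (continuous_partialDeriv hv I)]
    _ ≤ (d : ℝ) ^ k * sobolevInner k f f :=
        mul_le_mul_of_nonneg_left (Finset.sum_le_sum fun I _ => integral_sq_partialDeriv_le I)
          (by positivity)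

lemma exists_trigPoly_approx (hk : d < 2 * k) {f : (Fin d → ℝ) → ℝ} (hf : f ∈ SobolevZero k d)
    {ε : ℝ} (hε : 0 < ε) :
    ∃ F : Finset (Fin d → ℤ), ∀ x, |f x - trigPoly F (fourierCoef f) x| ≤ ε := by
  have hs := summable_fourierCoef hk hf
  have hu := tendstoUniformly_tsum hs.norm
    (f := fun ξ (x : Fin d → ℝ) => fourierCoef f ξ * expo ξ x)
    fun ξ x => by rw [norm_mul, norm_expo, mul_one]
  obtain ⟨F, hF⟩ := (Metric.tendstoUniformly_iff.1 hu ε hε).exists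
  refine ⟨F, fun x => ?_⟩
  have hx := (hF x).le
  rw [(hf.2.1.hasSum_fourierCoef hf.1 hs x).tsum_eq, dist_eq_norm] at hx
  simpa [trigPoly] using (Complex.abs_re_le_norm _).trans hx

end TrigonometricApproximation

/-! ### Taylor polynomials -/

section Taylor

variable {k d m : ℕ} {v : (Fin d → ℝ) → ℝ}

/-- The Taylor polynomial of degree `k` of `v` at `z`, evaluated at `y`. -/
def taylorPoly (k : ℕ) (v : (Fin d → ℝ) → ℝ) (z y : Fin d → ℝ) : ℝ :=
  ∑ j ∈ Finset.range (k + 1), (j.factorial : ℝ)⁻¹ * iteratedFDeriv ℝ j v z fun _ => y - z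

lemma iteratedDeriv_comp_line {E : Type*} [NormedAddCommGroup E] [NormedSpace ℝ E] {v : E → ℝ}
    (hv : ContDiff ℝ m v) (z h : E) (t : ℝ) :
    iteratedDeriv m (fun t : ℝ => v (z + t • h)) t
      = iteratedFDeriv ℝ m v (z + t • h) fun _ => h := by
  have shift : ContDiff ℝ m fun u => v (z + u) := hv.comp (contDiff_const.add contDiff_id)
  rw [iteratedDeriv_eq_iteratedFDeriv]
  have := (ContinuousLinearMap.toSpanSingleton ℝ h).iteratedFDeriv_comp_right shift t le_rfl
  refine (congrArg (fun L => L fun _ => (1 : ℝ)) this).trans ?_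
  simp [iteratedFDeriv_comp_add_left]

lemma sub_taylorPoly_eq_integral (hv : ContDiff ℝ (k + 1) v) (z y : Fin d → ℝ) :
    v y - taylorPoly k v z y = ∫ t in (0 : ℝ)..1, ((1 - t) ^ k / k.factorial) *
      iteratedFDeriv ℝ (k + 1) v (z + t • (y - z)) fun _ => y - z := by
  let φ (t : ℝ) : ℝ := v (z + t • (y - z))
  have hφ : ContDiff ℝ (k + 1) φ := hv.comp (by fun_prop)
  have iteratedDerivWithin_eq {j : ℕ} (hj : j ≤ k + 1) {t : ℝ} (ht : t ∈ Set.uIcc (0 : ℝ) 1) :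
      iteratedDerivWithin j φ (Set.uIcc 0 1) t
        = iteratedFDeriv ℝ j v (z + t • (y - z)) fun _ => y - z := by
    have hj' : (j : WithTop ℕ∞) ≤ k + 1 := by exact_mod_cast hj
    rw [iteratedDerivWithin_eq_iteratedDeriv (uniqueDiffOn_uIcc zero_ne_one)
      (hφ.of_le hj').contDiffAt ht, iteratedDeriv_comp_line (hv.of_le hj')]
  have taylor := taylor_integral_remainder (n := k) (x₀ := 0) (x := 1)
    (hφ.contDiffOn (s := Set.uIcc 0 1))
  have taylorPoly_eq : taylorWithinEval φ k (Set.uIcc 0 1) 0 1 = taylorPoly k v z y := by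
    rw [taylor_within_apply]
    refine Finset.sum_congr rfl fun j hj => ?_
    rw [iteratedDerivWithin_eq (Finset.mem_range.1 hj).le (by simp)]
    simp
  have φ_one : φ 1 = v y := by simp [φ]
  rw [φ_one, taylorPoly_eq] at taylor
  rw [taylor]
  exact intervalIntegral.integral_congr fun t ht => by
    simp only [iteratedDerivWithin_eq le_rfl ht, smul_eq_mul]

lemma iteratedFDeriv_diag_eq_sum (v : (Fin d → ℝ) → ℝ) (m : ℕ) (z h : Fin d → ℝ) :
    iteratedFDeriv ℝ m v z (fun _ => h)
      = ∑ I : Fin m → Fin d, (∏ j, h (I j)) * partialDeriv I v z := by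
  have basis_expansion : (fun _ : Fin m => h)
      = fun _ => ∑ i, h i • (Pi.single i (1 : ℝ) : Fin d → ℝ) := by
    funext _ i
    simp [Pi.single_apply]
  rw [basis_expansion, ContinuousMultilinearMap.map_sum]
  exact Finset.sum_congr rfl fun I _ => ContinuousMultilinearMap.map_smul_univ _ _ _

lemma abs_iteratedFDeriv_diag_le (v : (Fin d → ℝ) → ℝ) (m : ℕ) (z h : Fin d → ℝ) :
    |iteratedFDeriv ℝ m v z fun _ => h| ≤ ‖h‖ ^ m * derivSum m v z := by
  rw [iteratedFDeriv_diag_eq_sum, derivSum, Finset.mul_sum]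
  refine (Finset.abs_sum_le_sum_abs _ _).trans (Finset.sum_le_sum fun I _ => ?_)
  rw [abs_mul, Finset.abs_prod]
  gcongr
  simpa using Finset.prod_le_prod (s := Finset.univ) (fun j _ => abs_nonneg (h (I j)))
    fun j _ => norm_le_pi_norm h (I j)

lemma abs_sub_taylorPoly_le (hv : ContDiff ℝ (k + 1) v) (z y : Fin d → ℝ) :
    |v y - taylorPoly k v z y| ≤ ‖y - z‖ ^ (k + 1) *
      ∫ t in (0 : ℝ)..1, (1 - t) ^ k * derivSum (k + 1) v (z + t • (y - z)) := by
  rw [sub_taylorPoly_eq_integral hv, ← intervalIntegral.integral_const_mul, ← Real.norm_eq_abs]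
  have : Continuous (derivSum (k + 1) v) := continuous_derivSum (mod_cast hv)
  refine intervalIntegral.norm_integral_le_of_norm_le zero_le_one
    (Filter.Eventually.of_forall fun t ht => ?_)
    (Continuous.intervalIntegrable (by fun_prop) _ _)
  have ht' : 0 ≤ 1 - t := sub_nonneg.2 ht.2
  rw [Real.norm_eq_abs, abs_mul, abs_of_nonneg (by positivity), mul_left_comm]
  gcongr
  · exact div_le_self (by positivity) (by exact_mod_cast k.factorial_pos)
  · exact abs_iteratedFDeriv_diag_le v (k + 1) _ _

lemma continuous_taylorPoly (hv : ContDiff ℝ k v) :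
    Continuous (Function.uncurry (taylorPoly k v)) := by
  unfold Function.uncurry taylorPoly
  refine continuous_finsetSum _ fun j hj => ?_
  have hj : (j : WithTop ℕ∞) ≤ k := by exact_mod_cast Nat.lt_succ_iff.1 (Finset.mem_range.1 hj)
  have := hv.continuous_iteratedFDeriv (m := j) hj
  fun_prop

end Taylor

/-! ### Averages over cubes -/

section CubeAverages

variable {d k : ℕ} {b y : Fin d → ℝ} {h r : ℝ} {g φ : (Fin d → ℝ) → ℝ}

/-- The closed cube with lower corner `b` and side length `h`. -/
def closedCube (b : Fin d → ℝ) (h : ℝ) : Set (Fin d → ℝ) :=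
  Set.Icc b fun i => b i + h

lemma isCompact_closedCube (b : Fin d → ℝ) (h : ℝ) : IsCompact (closedCube b h) := isCompact_Icc

lemma measurableSet_closedCube (b : Fin d → ℝ) (h : ℝ) : MeasurableSet (closedCube b h) :=
  measurableSet_Icc

lemma convex_closedCube (b : Fin d → ℝ) (h : ℝ) : Convex ℝ (closedCube b h) := convex_Icc _ _

lemma volume_closedCube (b : Fin d → ℝ) (hh : 0 ≤ h) :
    volume (closedCube b h) = ENNReal.ofReal (h ^ d) := by
  simp [closedCube, Real.volume_Icc_pi, ENNReal.ofReal_pow hh]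

lemma volume_closedCube_ne_zero (b : Fin d → ℝ) (hh : 0 < h) : volume (closedCube b h) ≠ 0 := by
  rw [volume_closedCube b hh.le]
  exact (ENNReal.ofReal_pos.2 (by positivity)).ne'

lemma volumeReal_closedCube (b : Fin d → ℝ) (hh : 0 ≤ h) :
    volume.real (closedCube b h) = h ^ d := by
  rw [Measure.real, volume_closedCube b hh, ENNReal.toReal_ofReal (by positivity)]

lemma norm_sub_le_of_mem_closedCube (hh : 0 ≤ h) {x : Fin d → ℝ} (hx : x ∈ closedCube b h)
    (hy : y ∈ closedCube b h) : ‖x - y‖ ≤ h := by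
  refine (pi_norm_le_iff_of_nonneg hh).2 fun i => ?_
  rw [Pi.sub_apply, Real.norm_eq_abs, abs_le]
  constructor <;> linarith [hx.1 i, hx.2 i, hy.1 i, hy.2 i]

lemma integrableOn_closedCube {E : Type*} [NormedAddCommGroup E] {φ : (Fin d → ℝ) → E}
    (hφ : Continuous φ) (b : Fin d → ℝ) (h : ℝ) : IntegrableOn φ (closedCube b h) :=
  hφ.continuousOn.integrableOn_compact (isCompact_closedCube b h)

lemma setAverage_closedCube {E : Type*} [NormedAddCommGroup E] [NormedSpace ℝ E]
    (φ : (Fin d → ℝ) → E) (b : Fin d → ℝ) (hh : 0 ≤ h) :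
    ⨍ x in closedCube b h, φ x = (h ^ d)⁻¹ • ∫ x in closedCube b h, φ x := by
  rw [setAverage_eq, volumeReal_closedCube b hh]

lemma setAverage_closedCube_mono (hg : Continuous g) (hφ : Continuous φ) (b : Fin d → ℝ)
    (hh : 0 ≤ h) (hle : ∀ x ∈ closedCube b h, g x ≤ φ x) :
    ⨍ x in closedCube b h, g x ≤ ⨍ x in closedCube b h, φ x := by
  simp only [setAverage_closedCube _ b hh]
  exact smul_le_smul_of_nonneg_left (setIntegral_mono_on (integrableOn_closedCube hg b h)
    (integrableOn_closedCube hφ b h) (measurableSet_closedCube b h) hle) (by positivity)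

/-- The normalized `L^r` norm of `g` on the cube with lower corner `b` and side length `h`. -/
def cubeAvg (g : (Fin d → ℝ) → ℝ) (r : ℝ) (b : Fin d → ℝ) (h : ℝ) : ℝ :=
  (⨍ x in closedCube b h, g x ^ r) ^ (1 / r)

lemma setAverage_nonneg {α : Type*} [MeasurableSpace α] (μ : Measure α) (s : Set α) {φ : α → ℝ}
    (h0 : ∀ x, 0 ≤ φ x) : 0 ≤ ⨍ x in s, φ x ∂μ :=
  integral_nonneg h0

lemma setAverage_rpow_nonneg (h0 : ∀ x, 0 ≤ g x) (r : ℝ) (s : Set (Fin d → ℝ)) :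
    0 ≤ ⨍ x in s, g x ^ r :=
  setAverage_nonneg _ _ fun x => Real.rpow_nonneg (h0 x) r

lemma cubeAvg_nonneg (h0 : ∀ x, 0 ≤ g x) (r : ℝ) (b : Fin d → ℝ) (h : ℝ) : 0 ≤ cubeAvg g r b h :=
  Real.rpow_nonneg (setAverage_rpow_nonneg h0 r _) _

lemma setAverage_le_cubeAvg (hh : 0 < h) (hg : Continuous g) (h0 : ∀ x, 0 ≤ g x) (hr : 1 ≤ r) :
    ⨍ x in closedCube b h, g x ≤ cubeAvg g r b h := by
  have hr0 : 0 < r := zero_lt_one.trans_le hr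
  have jensen : (⨍ x in closedCube b h, g x) ^ r ≤ ⨍ x in closedCube b h, g x ^ r :=
    (convexOn_rpow hr).map_set_average_le
      ((Real.continuous_rpow_const hr0.le).continuousOn) isClosed_Ici
      (volume_closedCube_ne_zero b hh) (isCompact_closedCube b h).measure_lt_top.ne
      (Filter.Eventually.of_forall h0) (integrableOn_closedCube hg b h)
      (integrableOn_closedCube (hg.rpow_const fun _ => Or.inr hr0.le) b h)
  rw [cubeAvg, one_div]
  exact (Real.le_rpow_inv_iff_of_pos (setAverage_nonneg _ _ h0)
    (setAverage_rpow_nonneg h0 r _) hr0).2 jensen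

lemma setAverage_homothety_le (hh : 0 ≤ h) (hφ : Continuous φ) (h0 : ∀ x, 0 ≤ φ x)
    (hy : y ∈ closedCube b h) {s : ℝ} (hs : 0 < s) (hs1 : s ≤ 1) :
    ⨍ z in closedCube b h, φ (s • z + (1 - s) • y)
      ≤ (s ^ d)⁻¹ * ⨍ z in closedCube b h, φ z := by
  simp only [setAverage_closedCube _ b hh, smul_eq_mul]
  rw [mul_left_comm]
  refine mul_le_mul_of_nonneg_left ?_ (by positivity)
  set Q := closedCube b h
  have hQ : MeasurableSet Q := measurableSet_closedCube b h
  have integrable_indicator : Integrable (Q.indicator φ) :=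
    (integrableOn_closedCube hφ b h).integrable_indicator hQ
  have hcomp : Continuous fun z => φ (s • z + (1 - s) • y) := by fun_prop
  calc ∫ z in Q, φ (s • z + (1 - s) • y)
      = ∫ z, Q.indicator (fun z => φ (s • z + (1 - s) • y)) z := (integral_indicator hQ).symm
    _ ≤ ∫ z, Q.indicator φ (s • z + (1 - s) • y) := by
        refine integral_mono ((integrableOn_closedCube hcomp b h).integrable_indicator hQ)
          ((integrable_indicator.comp_add_right ((1 - s) • y)).comp_smul hs.ne') fun z => ?_
        by_cases hz : z ∈ Q
        · have : s • z + (1 - s) • y ∈ Q :=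
            convex_closedCube b h hz hy hs.le (by linarith) (by ring)
          simp [hz, this]
        · simp only [Set.indicator_of_notMem hz]
          exact Set.indicator_nonneg (fun _ _ => h0 _) _
    _ = (s ^ d)⁻¹ * ∫ z in Q, φ z := by
        rw [Measure.integral_comp_smul volume (fun z => Q.indicator φ (z + (1 - s) • y)) s,
          integral_add_right_eq_self (Q.indicator φ), integral_indicator hQ,
          Module.finrank_fin_fun, abs_of_pos (by positivity), smul_eq_mul]

lemma setAverage_segment_le (hh : 0 < h) (hg : Continuous g) (h0 : ∀ x, 0 ≤ g x) (hr : 1 ≤ r)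
    (hy : y ∈ closedCube b h) {t : ℝ} (ht : t ∈ Set.Ico (0 : ℝ) 1) :
    ⨍ z in closedCube b h, g (z + t • (y - z)) ≤ (1 - t) ^ (-(d / r : ℝ)) * cubeAvg g r b h := by
  have hr0 : 0 < r := zero_lt_one.trans_le hr
  have ht' : 0 < 1 - t := sub_pos.2 ht.2
  have segment_eq (z : Fin d → ℝ) : z + t • (y - z) = (1 - t) • z + (1 - (1 - t)) • y := by
    module
  simp only [segment_eq]
  calc ⨍ z in closedCube b h, g ((1 - t) • z + (1 - (1 - t)) • y)
      ≤ (⨍ z in closedCube b h, g ((1 - t) • z + (1 - (1 - t)) • y) ^ r) ^ (1 / r) :=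
        setAverage_le_cubeAvg (g := fun z => g ((1 - t) • z + (1 - (1 - t)) • y)) hh
          (by fun_prop) (fun _ => h0 _) hr
    _ ≤ (((1 - t) ^ d)⁻¹ * ⨍ z in closedCube b h, g z ^ r) ^ (1 / r) :=
        Real.rpow_le_rpow (setAverage_nonneg _ _ fun _ => Real.rpow_nonneg (h0 _) r)
          (setAverage_homothety_le hh.le (hg.rpow_const fun _ => Or.inr hr0.le)
            (fun _ => Real.rpow_nonneg (h0 _) r) hy ht' (by linarith [ht.1])) (by positivity)
    _ = (1 - t) ^ (-(d / r : ℝ)) * cubeAvg g r b h := by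
        rw [Real.mul_rpow (by positivity) (setAverage_rpow_nonneg h0 r _), ← Real.rpow_natCast,
          ← Real.rpow_neg ht'.le, ← Real.rpow_mul ht'.le, cubeAvg, neg_mul, mul_one_div]

lemma setAverage_intervalIntegral_swap {F : (Fin d → ℝ) → ℝ → ℝ}
    (hF : Continuous (Function.uncurry F)) (b : Fin d → ℝ) (hh : 0 ≤ h) :
    ⨍ z in closedCube b h, (∫ t in (0 : ℝ)..1, F z t)
      = ∫ t in (0 : ℝ)..1, ⨍ z in closedCube b h, F z t := by
  simp only [setAverage_closedCube _ b hh, smul_eq_mul]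
  rw [intervalIntegral.integral_const_mul]
  simp only [intervalIntegral.integral_of_le zero_le_one]
  have integrableOn_prod : IntegrableOn (Function.uncurry F) (closedCube b h ×ˢ Set.Icc (0 : ℝ) 1)
      (volume.prod volume) :=
    hF.continuousOn.integrableOn_compact ((isCompact_closedCube b h).prod isCompact_Icc)
  rw [integral_integral_swap]
  rw [Measure.prod_restrict]
  exact integrableOn_prod.mono_set (Set.prod_mono_right Set.Ioc_subset_Icc_self)

lemma integral_one_sub_rpow {a : ℝ} (ha : -1 < a) :
    ∫ t in (0 : ℝ)..1, (1 - t) ^ a = (a + 1)⁻¹ := by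
  rw [intervalIntegral.integral_comp_sub_left (fun t => t ^ a) 1, sub_self, sub_zero,
    integral_rpow (Or.inl ha), Real.one_rpow, Real.zero_rpow (by linarith), sub_zero, one_div]

lemma setAverage_remainder_le (hh : 0 < h) (hg : Continuous g) (h0 : ∀ x, 0 ≤ g x) (hr : 1 ≤ r)
    (hk : d / r < k + 1) (hy : y ∈ closedCube b h) :
    ⨍ z in closedCube b h, (∫ t in (0 : ℝ)..1, (1 - t) ^ k * g (z + t • (y - z)))
      ≤ (k + 1 - d / r)⁻¹ * cubeAvg g r b h := by
  have hexp : -1 < (k : ℝ) - d / r := by linarith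
  have integrable_rpow :
      IntervalIntegrable (fun t : ℝ => (1 - t) ^ ((k : ℝ) - d / r)) volume 0 1 := by
    have := (intervalIntegral.intervalIntegrable_rpow' hexp (a := 0) (b := 1)).comp_sub_left 1
    simpa using this.symm
  have continuous_slice : Continuous fun t : ℝ =>
      ⨍ z in closedCube b h, (1 - t) ^ k * g (z + t • (y - z)) := by
    have continuous_integral : Continuous fun t : ℝ =>
        ∫ z in closedCube b h, (1 - t) ^ k * g (z + t • (y - z)) :=
      continuous_parametric_integral_of_continuous (by unfold Function.uncurry; fun_prop)
        (isCompact_closedCube b h)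
    simp only [setAverage_closedCube _ b hh.le]
    exact continuous_integral.const_smul (h ^ d)⁻¹
  rw [setAverage_intervalIntegral_swap (by unfold Function.uncurry; fun_prop) b hh.le]
  calc ∫ t in (0 : ℝ)..1, ⨍ z in closedCube b h, (1 - t) ^ k * g (z + t • (y - z))
      ≤ ∫ t in (0 : ℝ)..1, (1 - t) ^ ((k : ℝ) - d / r) * cubeAvg g r b h := by
        refine intervalIntegral.integral_mono_on_of_le_Ioo zero_le_one
          (continuous_slice.intervalIntegrable _ _) (integrable_rpow.mul_const _) fun t ht => ?_
        have ht' : 0 < 1 - t := sub_pos.2 ht.2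
        rw [sub_eq_add_neg (k : ℝ), Real.rpow_add ht', Real.rpow_natCast, mul_assoc]
        exact (integral_const_mul _ _).trans_le (mul_le_mul_of_nonneg_left
          (setAverage_segment_le hh hg h0 hr hy ⟨ht.1.le, ht.2⟩) (by positivity))
    _ = (k + 1 - d / r)⁻¹ * cubeAvg g r b h := by
        rw [intervalIntegral.integral_mul_const, integral_one_sub_rpow hexp, sub_add_eq_add_sub]

end CubeAverages

/-! ### Polynomial approximation on cubes -/

lemma exists_forall_dist_le_abs_sub_le_mul_norm {X : Type*} [PseudoMetricSpace X] [CompactSpace X]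
    (W : Submodule ℝ C(X, ℝ)) [FiniteDimensional ℝ W] {ε : ℝ} (hε : 0 < ε) :
    ∃ δ > 0, ∀ f ∈ W, ∀ x y : X, dist x y ≤ δ → |f x - f y| ≤ ε * ‖f‖ := by
  have : ProperSpace W := FiniteDimensional.proper_real W
  have continuous_eval : Continuous fun p : W × X => (p.1 : C(X, ℝ)) p.2 := by fun_prop
  have compact : IsCompact (Metric.closedBall (0 : W) 1 ×ˢ (Set.univ : Set X)) :=
    (isCompact_closedBall 0 1).prod isCompact_univ
  obtain ⟨δ, hδ, hmod⟩ := Metric.uniformContinuousOn_iff_le.1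
    (compact.uniformContinuousOn_of_continuous continuous_eval.continuousOn) ε hε
  refine ⟨δ, hδ, fun f hf x y hxy => ?_⟩
  rcases eq_or_ne f 0 with rfl | hf0
  · simp
  have hnorm : 0 < ‖f‖ := norm_pos_iff.2 hf0
  let u : W := ‖f‖⁻¹ • ⟨f, hf⟩
  have hu : u ∈ Metric.closedBall (0 : W) 1 := by
    simp [u, norm_smul, hnorm.ne']
  have key := hmod (u, x) ⟨hu, trivial⟩ (u, y) ⟨hu, trivial⟩ (by simp [Prod.dist_eq, hxy])
  have u_apply (z : X) : (u : C(X, ℝ)) z = ‖f‖⁻¹ * f z := rfl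
  rwa [Real.dist_eq, u_apply, u_apply, ← mul_sub, abs_mul, abs_of_pos (inv_pos.2 hnorm),
    inv_mul_le_iff₀ hnorm, mul_comm] at key

section PolynomialApproximation

variable {d k : ℕ} {v : (Fin d → ℝ) → ℝ} {b z : Fin d → ℝ} {h r : ℝ}

/-- Evaluation of polynomials on the unit cube. -/
def cubeEval (d : ℕ) : MvPolynomial (Fin d) ℝ →ₐ[ℝ] C(Set.Icc (0 : Fin d → ℝ) 1, ℝ) :=
  MvPolynomial.aeval fun i => ⟨fun s => s.1 i, (continuous_apply i).comp continuous_subtype_val⟩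

/-- The polynomial functions of degree at most `k` on the unit cube. -/
def cubePolynomials (k d : ℕ) : Submodule ℝ C(Set.Icc (0 : Fin d → ℝ) 1, ℝ) :=
  (MvPolynomial.restrictTotalDegree (Fin d) ℝ k).map (cubeEval d).toLinearMap

instance finiteDimensional_cubePolynomials (k d : ℕ) :
    FiniteDimensional ℝ (cubePolynomials k d) :=
  inferInstanceAs (Module.Finite ℝ (Submodule.map _ _))

lemma prod_affine_mem_cubePolynomials {m : ℕ} (hm : m ≤ k) (a : Fin d → ℝ) (h : ℝ)
    (I : Fin m → Fin d) :
    ∏ j, cubeEval d (.C (a (I j)) + .C h * .X (I j)) ∈ cubePolynomials k d := by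
  rw [← map_prod]
  refine Submodule.mem_map_of_mem ((MvPolynomial.mem_restrictTotalDegree _ _ _).2 ?_)
  refine (MvPolynomial.totalDegree_finsetProd _ _).trans ?_
  refine (Finset.sum_le_card_nsmul _ _ 1 fun j _ => ?_).trans (by simpa using hm)
  refine (MvPolynomial.totalDegree_add _ _).trans (max_le (by simp) ?_)
  exact (MvPolynomial.totalDegree_mul _ _).trans (by simp)

/-- The Taylor polynomial of `v` at `z` on the cube with lower corner `b` and side length `h`,
rescaled to the unit cube. -/
def rescaledTaylor (k : ℕ) (v : (Fin d → ℝ) → ℝ) (b : Fin d → ℝ) (h : ℝ) (z : Fin d → ℝ) :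
    C(Set.Icc (0 : Fin d → ℝ) 1, ℝ) :=
  ⟨fun s => taylorPoly k v z (b + h • s.1), by unfold taylorPoly; fun_prop⟩

lemma rescaledTaylor_mem_cubePolynomials : rescaledTaylor k v b h z ∈ cubePolynomials k d := by
  have expansion : rescaledTaylor k v b h z = ∑ j ∈ Finset.range (k + 1), (j.factorial : ℝ)⁻¹ •
      ∑ I : Fin j → Fin d, partialDeriv I v z •
        ∏ i, cubeEval d (.C ((b - z) (I i)) + .C h * .X (I i)) := by
    ext s
    simp only [rescaledTaylor, taylorPoly, iteratedFDeriv_diag_eq_sum, cubeEval,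
      ContinuousMap.coe_mk, ContinuousMap.sum_apply, ContinuousMap.smul_apply,
      ContinuousMap.prod_apply, map_add, map_mul, MvPolynomial.aeval_X,
      MvPolynomial.algHom_C, ContinuousMap.add_apply, ContinuousMap.mul_apply, smul_eq_mul,
      mul_comm (partialDeriv _ v z)]
    simp [add_sub_right_comm]
  rw [expansion]
  exact Submodule.sum_mem _ fun j hj => Submodule.smul_mem _ _ <| Submodule.sum_mem _ fun I _ =>
    Submodule.smul_mem _ _ <|
      prod_affine_mem_cubePolynomials (Nat.lt_succ_iff.1 (Finset.mem_range.1 hj)) _ _ _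

lemma continuous_rescaledTaylor (hv : ContDiff ℝ k v) (b : Fin d → ℝ) (h : ℝ) :
    Continuous (rescaledTaylor k v b h) :=
  ContinuousMap.continuous_of_continuous_uncurry _ <| (continuous_taylorPoly hv).comp
    (f := fun q : (Fin d → ℝ) × Set.Icc (0 : Fin d → ℝ) 1 => (q.1, b + h • q.2.1)) (by fun_prop)

lemma setAverage_rescaledTaylor_apply (hv : ContDiff ℝ k v) (b : Fin d → ℝ) (hh : 0 ≤ h)
    (s : Set.Icc (0 : Fin d → ℝ) 1) :
    (⨍ z in closedCube b h, rescaledTaylor k v b h z) s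
      = ⨍ z in closedCube b h, taylorPoly k v z (b + h • s.1) := by
  simp only [setAverage_closedCube _ b hh, ContinuousMap.smul_apply]
  congr 1
  exact ((ContinuousMap.evalCLM ℝ s).integral_comp_comm
    (integrableOn_closedCube (continuous_rescaledTaylor hv b h) b h)).symm

lemma add_smul_mem_closedCube (hh : 0 ≤ h) (s : Set.Icc (0 : Fin d → ℝ) 1) :
    b + h • s.1 ∈ closedCube b h :=
  ⟨fun i => by simpa using mul_nonneg hh (s.2.1 i),
    fun i => by simpa using mul_le_of_le_one_right hh (s.2.2 i)⟩

lemma abs_sub_setAverage_taylorPoly_le (hv : ContDiff ℝ (k + 1) v) (hh : 0 < h) (hr : 1 ≤ r)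
    (hk : d / r < k + 1) {y : Fin d → ℝ} (hy : y ∈ closedCube b h) :
    |v y - ⨍ z in closedCube b h, taylorPoly k v z y|
      ≤ (k + 1 - d / r)⁻¹ * (h ^ (k + 1) * cubeAvg (derivSum (k + 1) v) r b h) := by
  have hvk : ContDiff ℝ k v := hv.of_le (by exact_mod_cast k.le_succ)
  have hg : Continuous (derivSum (k + 1) v) := continuous_derivSum (mod_cast hv)
  have hTaylor : Continuous fun z => taylorPoly k v z y := (continuous_taylorPoly hvk).comp
    (f := fun z => (z, y)) (by fun_prop)
  have : IsFiniteMeasure (volume.restrict (closedCube b h)) :=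
    ⟨by simpa using (isCompact_closedCube b h).measure_lt_top⟩
  have : NeZero (volume.restrict (closedCube b h)) :=
    ⟨by simpa using volume_closedCube_ne_zero b hh⟩
  have average_remainder : v y - ⨍ z in closedCube b h, taylorPoly k v z y
      = ⨍ z in closedCube b h, (v y - taylorPoly k v z y) := by
    rw [average_eq, average_eq, integral_sub (integrable_const _)
      (integrableOn_closedCube hTaylor b h), integral_const, smul_sub, smul_smul,
      inv_mul_cancel₀ measureReal_univ_pos.ne', one_smul]
  have continuous_integral : Continuous fun z =>
      ∫ t in (0 : ℝ)..1, (1 - t) ^ k * derivSum (k + 1) v (z + t • (y - z)) := by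
    refine intervalIntegral.continuous_parametric_intervalIntegral_of_continuous' ?_ 0 1
    unfold Function.uncurry
    fun_prop
  calc |v y - ⨍ z in closedCube b h, taylorPoly k v z y|
      ≤ ⨍ z in closedCube b h, |v y - taylorPoly k v z y| := by
        rw [average_remainder]
        exact abs_integral_le_integral_abs
    _ ≤ ⨍ z in closedCube b h, h ^ (k + 1) *
          ∫ t in (0 : ℝ)..1, (1 - t) ^ k * derivSum (k + 1) v (z + t • (y - z)) := by
        refine setAverage_closedCube_mono (continuous_const.sub hTaylor).abs
          (continuous_const.mul continuous_integral) b hh.le fun z hz => ?_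
        refine (abs_sub_taylorPoly_le hv z y).trans (mul_le_mul_of_nonneg_right
          (pow_le_pow_left₀ (norm_nonneg _) (norm_sub_le_of_mem_closedCube hh.le hy hz) _) ?_)
        exact intervalIntegral.integral_nonneg zero_le_one fun t ht =>
          mul_nonneg (pow_nonneg (sub_nonneg.2 ht.2) _) (derivSum_nonneg _ _ _)
    _ ≤ h ^ (k + 1) * ((k + 1 - d / r)⁻¹ * cubeAvg (derivSum (k + 1) v) r b h) :=
        (integral_const_mul _ _).trans_le (mul_le_mul_of_nonneg_left
          (setAverage_remainder_le hh hg (derivSum_nonneg _ _) hr hk hy) (by positivity))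
    _ = _ := mul_left_comm _ _ _

/-- Bramble–Hilbert estimate: the Taylor polynomials at all base points of the cube are averaged. -/
theorem exists_cubePolynomial_abs_sub_le (hv : ContDiff ℝ (k + 1) v) (b : Fin d → ℝ) (hh : 0 < h)
    (hr : 1 ≤ r) (hk : d / r < k + 1) :
    ∃ p ∈ cubePolynomials k d, ∀ s, |v (b + h • s.1) - p s|
      ≤ (k + 1 - d / r)⁻¹ * (h ^ (k + 1) * cubeAvg (derivSum (k + 1) v) r b h) := by
  have hvk : ContDiff ℝ k v := hv.of_le (by exact_mod_cast k.le_succ)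
  refine ⟨⨍ z in closedCube b h, rescaledTaylor k v b h z, ?_, fun s => ?_⟩
  · exact (cubePolynomials k d).convex.set_average_mem (Submodule.closed_of_finiteDimensional _)
      (volume_closedCube_ne_zero b hh) (isCompact_closedCube b h).measure_lt_top.ne
      (Filter.Eventually.of_forall fun _ => rescaledTaylor_mem_cubePolynomials)
      (integrableOn_closedCube (continuous_rescaledTaylor hvk b h) b h)
  · rw [setAverage_rescaledTaylor_apply hvk b hh.le]
    exact abs_sub_setAverage_taylorPoly_le hv hh hr hk (add_smul_mem_closedCube hh.le s)

end PolynomialApproximation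

/-! ### Grid points in cubes and the multiresolution norm -/

section Grid

variable {d N : ℕ} {a : Fin d → ℝ} {h : ℝ}

/-- The half-open cube with lower corner `a` and side length `h`, as in `IsCube`. -/
def halfOpenCube (a : Fin d → ℝ) (h : ℝ) : Set (Fin d → ℝ) :=
  Set.univ.pi fun i => Set.Ico (a i) (a i + h)

lemma volumeReal_halfOpenCube (a : Fin d → ℝ) (hh : 0 ≤ h) :
    volume.real (halfOpenCube a h) = h ^ d := by
  rw [Measure.real, halfOpenCube, Real.volume_pi_Ico, ENNReal.toReal_prod]
  simp [hh]

lemma closure_halfOpenCube (hh : 0 < h) : closure (halfOpenCube a h) = closedCube a h := by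
  rw [halfOpenCube, closure_pi_set, closedCube, ← Set.pi_univ_Icc]
  simp [closure_Ico, hh.ne']

lemma Icc_subset_unitInterval_of_halfOpenCube_subset (hh : 0 < h)
    (hs : halfOpenCube a h ⊆ Set.Icc 0 1) (i : Fin d) : 0 ≤ a i ∧ a i + h ≤ 1 := by
  have hs' : closedCube a h ⊆ Set.Icc 0 1 :=
    closure_halfOpenCube (a := a) hh ▸ closure_minimal hs isClosed_Icc
  exact ⟨(hs' ⟨le_rfl, fun i => by simpa using hh.le⟩).1 i,
    (hs' ⟨fun i => by simpa using hh.le, le_rfl⟩).2 i⟩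

lemma half_mul_le_card_filter_Ico {a : ℝ} (ha : 0 ≤ a) (ha1 : a + h ≤ 1) (hNh : 2 ≤ N * h) :
    N * h / 2 ≤ ((Finset.univ.filter fun n : Fin N =>
      ((n : ℕ) : ℝ) / N ∈ Set.Ico a (a + h)).card : ℝ) := by
  have hN : (0 : ℝ) < N := (Nat.cast_nonneg N).lt_of_ne fun h0 => by
    rw [← h0, zero_mul] at hNh
    norm_num at hNh
  have card_Ico_le : (Finset.Ico ⌈N * a⌉₊ ⌈N * (a + h)⌉₊).card ≤
      (Finset.univ.filter fun n : Fin N => ((n : ℕ) : ℝ) / N ∈ Set.Ico a (a + h)).card := by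
    refine Finset.card_le_card_of_surjOn (fun n : Fin N => (n : ℕ)) fun m hm => ?_
    rw [Finset.mem_coe, Finset.mem_Ico, Nat.ceil_le, Nat.lt_ceil] at hm
    have hmN : m < N := by
      have : (m : ℝ) < N := hm.2.trans_le (mul_le_of_le_one_right hN.le ha1)
      exact_mod_cast this
    refine ⟨⟨m, hmN⟩, ?_, rfl⟩
    simpa [le_div_iff₀ hN, div_lt_iff₀ hN, mul_comm] using hm
  have le_card_Ico : (⌈N * (a + h)⌉₊ : ℝ) - ⌈N * a⌉₊
      ≤ (Finset.Ico ⌈N * a⌉₊ ⌈N * (a + h)⌉₊).card := by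
    rw [Nat.card_Ico, sub_le_iff_le_add]
    exact_mod_cast le_tsub_add
  have := Nat.le_ceil (N * (a + h))
  have := Nat.ceil_lt_add_one (mul_nonneg hN.le ha)
  have : ((Finset.Ico ⌈N * a⌉₊ ⌈N * (a + h)⌉₊).card : ℝ) ≤ _ := Nat.cast_le.2 card_Ico_le
  linarith

lemma half_mul_pow_le_card_gridIn (hh : 0 < h) (hs : halfOpenCube a h ⊆ Set.Icc 0 1)
    (hNh : 2 ≤ N * h) : (N * h / 2) ^ d ≤ ((gridIn N (halfOpenCube a h)).card : ℝ) := by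
  classical
  have gridIn_eq_piFinset : gridIn N (halfOpenCube a h) = Fintype.piFinset fun i =>
      Finset.univ.filter fun n : Fin N => ((n : ℕ) : ℝ) / N ∈ Set.Ico (a i) (a i + h) := by
    ext τ
    simp [gridIn, halfOpenCube, gridPoint, Set.mem_pi]
  have corner := Icc_subset_unitInterval_of_halfOpenCube_subset hh hs
  rw [gridIn_eq_piFinset, Fintype.card_piFinset, Nat.cast_prod]
  calc (N * h / 2) ^ d = ∏ _i : Fin d, (N * h / 2) := by rw [Finset.prod_const, Finset.card_fin]
    _ ≤ _ := Finset.prod_le_prod (fun _ _ => by linarith) fun i _ =>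
      half_mul_le_card_filter_Ico (corner i).1 (corner i).2 hNh

theorem IsNormalSystem.exists_pow_le_card_gridIn {c : ℝ} {𝓑 : Set (Set (Fin d → ℝ))}
    (h𝓑 : IsNormalSystem c 𝓑) (hd : d ≠ 0) (hh : 0 < h) (hs : halfOpenCube a h ⊆ Set.Icc 0 1)
    (hN : 2 * c ≤ N * h) :
    ∃ B ∈ 𝓑, B ⊆ halfOpenCube a h ∧ (N * h / (2 * c)) ^ d ≤ ((gridIn N B).card : ℝ) := by
  obtain ⟨hc, hcubes, hnormal⟩ := h𝓑
  have hc0 : 0 < c := one_pos.trans hc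
  have hh1 : h ≤ 1 := by
    have := Icc_subset_unitInterval_of_halfOpenCube_subset hh hs ⟨0, Nat.pos_of_ne_zero hd⟩
    linarith
  obtain ⟨B, hB, hBs, hvol⟩ := hnormal (halfOpenCube a h) ⟨a, h, hh, hh1, rfl, hs⟩
  obtain ⟨a', h', hh', -, hB', hs'⟩ := hcubes B hB
  change B = halfOpenCube a' h' at hB'
  subst hB'
  rw [volumeReal_halfOpenCube a hh.le, volumeReal_halfOpenCube a' hh'.le] at hvol
  have hside : h / c ≤ h' := by
    refine le_of_pow_le_pow_left₀ hd hh'.le (le_trans ?_ hvol)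
    rw [div_pow]
    gcongr
    exact le_self_pow₀ hc.le hd
  have hNside : N * h / c ≤ N * h' := by
    rw [mul_div_assoc]
    gcongr
  refine ⟨_, hB, hBs, le_trans ?_ (half_mul_pow_le_card_gridIn hh' hs'
    (((le_div_iff₀ hc0).2 hN).trans hNside))⟩
  rw [mul_comm 2 c, ← div_div]
  have : 0 ≤ N * h / c := by positivity
  gcongr

end Grid

section MultiresNorm

variable {d N : ℕ} {𝓑 : Set (Set (Fin d → ℝ))} {y : (Fin d → Fin N) → ℝ} {A : ℝ}

lemma abs_sum_gridIn_le_multiresNorm_mul {B : Set (Fin d → ℝ)} (hB : B ∈ 𝓑)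
    (y : (Fin d → Fin N) → ℝ) :
    |∑ τ ∈ gridIn N B, y τ| ≤ multiresNorm 𝓑 y * Real.sqrt ((gridIn N B).card : ℝ) := by
  have bddAbove : BddAbove (Set.range fun B : 𝓑 => |∑ τ ∈ gridIn N (B : Set (Fin d → ℝ)), y τ| /
      Real.sqrt ((gridIn N (B : Set (Fin d → ℝ))).card : ℝ)) := by
    refine ⟨∑ τ, |y τ|, Set.forall_mem_range.2 fun B => ?_⟩
    have abs_sum_le : |∑ τ ∈ gridIn N (B : Set (Fin d → ℝ)), y τ| ≤ ∑ τ, |y τ| :=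
      (Finset.abs_sum_le_sum_abs _ _).trans
        (Finset.sum_le_sum_of_subset_of_nonneg (Finset.subset_univ _) fun _ _ _ => abs_nonneg _)
    rcases (gridIn N (B : Set (Fin d → ℝ))).card.eq_zero_or_pos with h0 | h0
    · simp only [h0, Nat.cast_zero, Real.sqrt_zero, div_zero]
      exact Finset.sum_nonneg fun _ _ => abs_nonneg _
    · exact (div_le_self (abs_nonneg _)
        (Real.one_le_sqrt.2 (by exact_mod_cast h0))).trans abs_sum_le
  rcases (gridIn N B).card.eq_zero_or_pos with h0 | h0
  · simp [Finset.card_eq_zero.1 h0]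
  · rw [← div_le_iff₀ (Real.sqrt_pos.2 (by exact_mod_cast h0))]
    exact le_ciSup bddAbove ⟨B, hB⟩

lemma multiresNorm_nonneg (𝓑 : Set (Set (Fin d → ℝ))) (y : (Fin d → Fin N) → ℝ) :
    0 ≤ multiresNorm 𝓑 y :=
  Real.iSup_nonneg fun _ => by positivity

lemma multiresNorm_le (hA : 0 ≤ A)
    (h : ∀ B ∈ 𝓑, |∑ τ ∈ gridIn N B, y τ| ≤ A * Real.sqrt ((gridIn N B).card : ℝ)) :
    multiresNorm 𝓑 y ≤ A :=
  Real.iSup_le (fun B => div_le_of_le_mul₀ (Real.sqrt_nonneg _) hA (h B B.2)) hA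

lemma multiresNorm_add_le (𝓑 : Set (Set (Fin d → ℝ))) (y z : (Fin d → Fin N) → ℝ) :
    multiresNorm 𝓑 (y + z) ≤ multiresNorm 𝓑 y + multiresNorm 𝓑 z := by
  refine multiresNorm_le (add_nonneg (multiresNorm_nonneg _ _) (multiresNorm_nonneg _ _))
    fun B hB => ?_
  simp only [Pi.add_apply, Finset.sum_add_distrib, add_mul]
  exact (abs_add_le _ _).trans (add_le_add (abs_sum_gridIn_le_multiresNorm_mul hB y)
    (abs_sum_gridIn_le_multiresNorm_mul hB z))

lemma multiresNorm_smul_le (𝓑 : Set (Set (Fin d → ℝ))) (s : ℝ) (y : (Fin d → Fin N) → ℝ) :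
    multiresNorm 𝓑 (s • y) ≤ |s| * multiresNorm 𝓑 y := by
  refine multiresNorm_le (mul_nonneg (abs_nonneg _) (multiresNorm_nonneg _ _)) fun B hB => ?_
  simp only [Pi.smul_apply, smul_eq_mul, ← Finset.mul_sum, abs_mul, mul_assoc]
  exact mul_le_mul_of_nonneg_left (abs_sum_gridIn_le_multiresNorm_mul hB y) (abs_nonneg _)

lemma multiresNorm_le_of_forall_abs_le (𝓑 : Set (Set (Fin d → ℝ))) {ε : ℝ} (hε : 0 ≤ ε)
    (h : ∀ τ, |y τ| ≤ ε) : multiresNorm 𝓑 y ≤ ε * Real.sqrt ((N : ℝ) ^ d) := by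
  refine multiresNorm_le (by positivity) fun B _ => ?_
  have card_le : ((gridIn N B).card : ℝ) ≤ (N : ℝ) ^ d := by
    exact_mod_cast (Finset.card_le_univ (gridIn N B)).trans_eq (by simp)
  calc |∑ τ ∈ gridIn N B, y τ| ≤ ∑ _ ∈ gridIn N B, ε :=
        (Finset.abs_sum_le_sum_abs _ _).trans (Finset.sum_le_sum fun τ _ => h τ)
    _ = ε * (Real.sqrt ((gridIn N B).card : ℝ) * Real.sqrt ((gridIn N B).card : ℝ)) := by
        rw [Real.mul_self_sqrt (by positivity), Finset.sum_const, nsmul_eq_mul, mul_comm]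
    _ ≤ ε * Real.sqrt ((N : ℝ) ^ d) * Real.sqrt ((gridIn N B).card : ℝ) := by
        rw [mul_assoc]
        gcongr

end MultiresNorm

/-! ### The local estimate -/

section GridCell

variable {d M : ℕ} {a b : Fin d → ℝ} {h : ℝ}

/-- The closed cell of side length `1 / M` with lower corner `gridPoint m`. -/
def gridCell (m : Fin d → Fin M) : Set (Fin d → ℝ) :=
  closedCube (gridPoint m) (M : ℝ)⁻¹

lemma gridCell_subset_Icc (m : Fin d → Fin M) : gridCell m ⊆ Set.Icc 0 1 := by
  refine Set.Icc_subset_Icc (fun _ => div_nonneg (Nat.cast_nonneg _) (Nat.cast_nonneg _))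
    fun i => ?_
  have hM : (0 : ℝ) < M := by exact_mod_cast (m i).pos
  have hm : ((m i : ℕ) : ℝ) + 1 ≤ M := by exact_mod_cast (m i).2
  rw [gridPoint, ← one_div, ← add_div]
  exact (div_le_one hM).2 hm

lemma exists_mem_gridCell (hM : 0 < M) (ha : a ∈ Set.Icc 0 1) :
    ∃ m : Fin d → Fin M, a ∈ gridCell m := by
  have hM' : (0 : ℝ) < M := by exact_mod_cast hM
  have ceil_le (i : Fin d) : ⌈a i * M⌉₊ ≤ M :=
    Nat.ceil_le.2 (mul_le_of_le_one_left hM'.le (ha.2 i))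
  refine ⟨fun i => ⟨⌈a i * M⌉₊ - 1, by have := ceil_le i; omega⟩, fun i => ?_, fun i => ?_⟩
  · have hpos : 0 ≤ a i * M := mul_nonneg (ha.1 i) hM'.le
    rw [gridPoint, div_le_iff₀ hM', ← Nat.le_floor_iff hpos]
    exact tsub_le_iff_right.2 (Nat.ceil_le_floor_add_one _)
  · simp only [gridPoint, ← one_div, ← add_div, le_div_iff₀ hM']
    refine (Nat.le_ceil _).trans ?_
    exact_mod_cast le_tsub_add

lemma image_affine_closedCube (hh : 0 < h) (ε : ℝ) :
    (fun s => b + h • s) '' closedCube a ε = closedCube (b + h • a) (h * ε) := by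
  ext x
  constructor
  · rintro ⟨s, ⟨hs, hs'⟩, rfl⟩
    refine ⟨fun i => ?_, fun i => ?_⟩
    · simpa using mul_le_mul_of_nonneg_left (hs i) hh.le
    · simpa [add_assoc, ← mul_add] using mul_le_mul_of_nonneg_left (hs' i) hh.le
  · rintro ⟨hx, hx'⟩
    refine ⟨h⁻¹ • (x - b), ⟨fun i => ?_, fun i => ?_⟩, by simp [hh.ne']⟩
    · have := hx i
      simp only [Pi.add_apply, Pi.smul_apply, Pi.sub_apply, smul_eq_mul,
        le_inv_mul_iff₀ hh] at this ⊢
      linarith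
    · have := hx' i
      simp only [Pi.add_apply, Pi.smul_apply, Pi.sub_apply, smul_eq_mul,
        inv_mul_le_iff₀ hh] at this ⊢
      linarith

lemma exists_eq_add_smul_of_mem_closedCube (hh : 0 < h) {x : Fin d → ℝ} (hx : x ∈ closedCube b h) :
    ∃ s : Set.Icc (0 : Fin d → ℝ) 1, x = b + h • s.1 := by
  have : x ∈ (fun s => b + h • s) '' closedCube 0 1 := by
    rwa [image_affine_closedCube hh, smul_zero, add_zero, mul_one]
  obtain ⟨s, hs, rfl⟩ := this
  exact ⟨⟨s, by simpa [closedCube, ← Pi.one_def] using hs⟩, rfl⟩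

end GridCell

section LocalEstimate

variable {d k : ℕ} {r c : ℝ}

lemma IsNormalSystem.exists_subset_image_gridCell {N L : ℕ} {𝓑 : Set (Set (Fin d → ℝ))}
    (h𝓑 : IsNormalSystem c 𝓑) (hd : d ≠ 0) {b : Fin d → ℝ} {h : ℝ} (hh : 0 < h)
    (hs : closedCube b h ⊆ Set.Icc 0 1) (hL : 0 < L) (hN : 2 * L * c ≤ N * h)
    (l : Fin d → Fin L) :
    ∃ B ∈ 𝓑, B ⊆ (fun s => b + h • s) '' gridCell l ∧
      (N * h / (2 * L * c)) ^ d ≤ ((gridIn N B).card : ℝ) := by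
  have hL' : (0 : ℝ) < L := by exact_mod_cast hL
  have halfOpenCube_subset : halfOpenCube (b + h • gridPoint l) (h * (L : ℝ)⁻¹)
      ⊆ (fun s => b + h • s) '' gridCell l := by
    rw [gridCell, image_affine_closedCube hh, halfOpenCube, closedCube, ← Set.pi_univ_Icc]
    exact Set.pi_mono fun i _ => Set.Ico_subset_Icc_self
  have image_subset : (fun s => b + h • s) '' gridCell l ⊆ Set.Icc 0 1 := by
    rintro _ ⟨s, hsl, rfl⟩
    exact hs (add_smul_mem_closedCube hh.le ⟨s, gridCell_subset_Icc l hsl⟩)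
  obtain ⟨B, hB, hBs, hcard⟩ := h𝓑.exists_pow_le_card_gridIn hd (N := N) (by positivity)
    (halfOpenCube_subset.trans image_subset)
    (by rw [← mul_assoc, le_mul_inv_iff₀ hL']; linarith)
  refine ⟨B, hB, hBs.trans halfOpenCube_subset, ?_⟩
  convert hcard using 2
  field_simp

lemma abs_le_div_sqrt_card_add {ι : Type*} {S : Finset ι} (hS : S.Nonempty) {w : ι → ℝ}
    {a A E : ℝ} (hsum : |∑ i ∈ S, w i| ≤ A * Real.sqrt S.card) (hw : ∀ i ∈ S, |w i - a| ≤ E) :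
    |a| ≤ A / Real.sqrt S.card + E := by
  have hcard : (0 : ℝ) < S.card := by exact_mod_cast hS.card_pos
  have abs_sum_sub_le : |∑ i ∈ S, w i - S.card * a| ≤ S.card * E := by
    rw [← nsmul_eq_mul, ← nsmul_eq_mul, ← Finset.sum_const, ← Finset.sum_sub_distrib]
    exact (Finset.abs_sum_le_sum_abs _ _).trans (Finset.sum_le_card_nsmul _ _ _ hw)
  have card_mul_le : S.card * |a| ≤ A * Real.sqrt S.card + S.card * E := by
    have := abs_sub_abs_le_abs_sub ((S.card : ℝ) * a) (∑ i ∈ S, w i)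
    rw [abs_sub_comm, abs_mul, Nat.abs_cast] at this
    linarith
  have sqrt_div : A * Real.sqrt S.card = S.card * (A / Real.sqrt S.card) := by
    rw [mul_div_left_comm, Real.div_sqrt]
  rwa [sqrt_div, ← mul_add, mul_le_mul_iff_right₀ hcard] at card_mul_le

lemma IsNormalSystem.norm_le_of_abs_sub_le {N L : ℕ} {𝓑 : Set (Set (Fin d → ℝ))}
    (h𝓑 : IsNormalSystem c 𝓑) (hd : d ≠ 0) {b : Fin d → ℝ} {h : ℝ} (hh : 0 < h)
    (hs : closedCube b h ⊆ Set.Icc 0 1) (hL : 0 < L) (hNpos : 0 < N * h)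
    (hN : 2 * L * c ≤ N * h)
    {p : C(Set.Icc (0 : Fin d → ℝ) 1, ℝ)} {v : (Fin d → ℝ) → ℝ} {A E : ℝ}
    (hp : ∀ s t, dist s t ≤ (L : ℝ)⁻¹ → |p s - p t| ≤ 1 / 2 * ‖p‖)
    (hv : ∀ s, |v (b + h • s.1) - p s| ≤ E) (hA : multiresNorm 𝓑 (sample N v) ≤ A) :
    ‖p‖ ≤ 2 * (Real.sqrt ((2 * L * c) ^ d) * (A / Real.sqrt ((N * h) ^ d)) + E) := by
  have hc : 0 < c := one_pos.trans h𝓑.1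
  have hA0 : 0 ≤ A := (multiresNorm_nonneg _ _).trans hA
  suffices abs_le : ∀ s, |p s| ≤
      Real.sqrt ((2 * L * c) ^ d) * (A / Real.sqrt ((N * h) ^ d)) + (1 / 2 * ‖p‖ + E) by
    have : Nonempty (Set.Icc (0 : Fin d → ℝ) 1) := ⟨⟨0, by simp⟩⟩
    linarith [(ContinuousMap.norm_le_of_nonempty p).2 abs_le]
  intro s
  obtain ⟨l, hl⟩ := exists_mem_gridCell hL s.2
  obtain ⟨B, hB, hBs, hcard⟩ := h𝓑.exists_subset_image_gridCell hd hh hs hL hN l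
  have hcard0 : (0 : ℝ) < (gridIn N B).card := lt_of_lt_of_le (by positivity) hcard
  have sample_sub_le : ∀ τ ∈ gridIn N B, |sample N v τ - p s| ≤ 1 / 2 * ‖p‖ + E := by
    intro τ hτ
    have hτB : gridPoint τ ∈ B := by simpa [gridIn] using hτ
    obtain ⟨t, ht, hτt⟩ := hBs hτB
    have hdist := hp ⟨t, gridCell_subset_Icc l ht⟩ s
      ((dist_eq_norm t s.1).trans_le (norm_sub_le_of_mem_closedCube (by positivity) ht hl))
    have hvt := hv ⟨t, gridCell_subset_Icc l ht⟩
    rw [sample, ← hτt]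
    refine (abs_sub_le _ (p ⟨t, gridCell_subset_Icc l ht⟩) _).trans ?_
    linarith
  have key := abs_le_div_sqrt_card_add (Finset.card_pos.1 (by exact_mod_cast hcard0))
    ((abs_sum_gridIn_le_multiresNorm_mul hB _).trans
      (mul_le_mul_of_nonneg_right hA (Real.sqrt_nonneg _))) sample_sub_le
  have sqrt_le : Real.sqrt ((N * h) ^ d)
      ≤ Real.sqrt ((2 * L * c) ^ d) * Real.sqrt (gridIn N B).card := by
    rw [← Real.sqrt_mul (by positivity)]
    refine Real.sqrt_le_sqrt ?_
    rwa [← div_le_iff₀' (by positivity), ← div_pow]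
  have hsqrt : 0 < Real.sqrt ((N * h) ^ d) := Real.sqrt_pos.2 (by positivity)
  have hsqrt' : 0 < Real.sqrt (gridIn N B).card := Real.sqrt_pos.2 hcard0
  refine key.trans ?_
  gcongr ?_ + _
  rw [← mul_div_assoc, div_le_div_iff₀ hsqrt' hsqrt, mul_comm _ A, mul_assoc]
  gcongr

/-- A polynomial varies little on a small subcube around its maximum, so the samples of `v` in the
subcube control the maximum of the polynomial approximating `v`. -/
theorem exists_local_estimate (hd : d ≠ 0) (hr : 1 ≤ r) (hk : d / r < k + 1) (hc : 1 < c) :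
    ∃ C₁ C₀ : ℝ, 1 ≤ C₁ ∧ 1 ≤ C₀ ∧ ∀ 𝓑 : Set (Set (Fin d → ℝ)), IsNormalSystem c 𝓑 →
      ∀ (N : ℕ) (v : (Fin d → ℝ) → ℝ), ContDiff ℝ (k + 1) v →
      ∀ A : ℝ, multiresNorm 𝓑 (sample N v) ≤ A →
      ∀ (b : Fin d → ℝ) (h : ℝ), 0 < h → closedCube b h ⊆ Set.Icc 0 1 → C₀ ≤ N * h →
      ∀ y ∈ closedCube b h, |v y| ≤ C₁ * (A / Real.sqrt ((N * h) ^ d) +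
        h ^ (k + 1) * cubeAvg (derivSum (k + 1) v) r b h) := by
  obtain ⟨δ, hδ, hmod⟩ := exists_forall_dist_le_abs_sub_le_mul_norm (cubePolynomials k d)
    (one_half_pos (α := ℝ))
  obtain ⟨L', hLδ⟩ := exists_nat_one_div_lt hδ
  set L := L' + 1
  have hL : (1 : ℝ) ≤ L := by exact_mod_cast Nat.le_add_left 1 L'
  set K := (k + 1 - d / r : ℝ)⁻¹
  set D := Real.sqrt ((2 * L * c) ^ d)
  have hC₀ : 1 ≤ 2 * L * c := by nlinarith
  refine ⟨max 1 (max (2 * D) (3 * K)), 2 * L * c, le_max_left _ _, hC₀, ?_⟩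
  intro 𝓑 h𝓑 N v hv A hA b h hh hsub hNh y hy
  have hA0 : 0 ≤ A / Real.sqrt ((N * h) ^ d) :=
    div_nonneg ((multiresNorm_nonneg _ _).trans hA) (Real.sqrt_nonneg _)
  set G := h ^ (k + 1) * cubeAvg (derivSum (k + 1) v) r b h
  have hG : 0 ≤ G := mul_nonneg (by positivity) (cubeAvg_nonneg (derivSum_nonneg _ _) _ _ _)
  obtain ⟨p, hp, hvp⟩ := exists_cubePolynomial_abs_sub_le hv b hh hr hk
  have norm_le := h𝓑.norm_le_of_abs_sub_le hd hh hsub (Nat.succ_pos L')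
    (one_pos.trans_le (hC₀.trans hNh)) hNh
    (fun s t hst => hmod p hp s t (hst.trans (by simpa [L] using hLδ.le))) hvp hA
  obtain ⟨s, rfl⟩ := exists_eq_add_smul_of_mem_closedCube hh hy
  calc |v (b + h • s.1)| ≤ |p s| + |v (b + h • s.1) - p s| := by
        linarith [abs_sub_abs_le_abs_sub (v (b + h • s.1)) (p s)]
    _ ≤ 2 * (D * (A / Real.sqrt ((N * h) ^ d)) + K * G) + K * G :=
        add_le_add ((p.norm_coe_le_norm s).trans norm_le) (hvp s)
    _ = 2 * D * (A / Real.sqrt ((N * h) ^ d)) + 3 * K * G := by ring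
    _ ≤ max 1 (max (2 * D) (3 * K)) * (A / Real.sqrt ((N * h) ^ d) + G) := by
        rw [mul_add]
        gcongr <;> simp

end LocalEstimate

/-! ### Superlevel sets of cell averages -/

section HighCells

variable {d M : ℕ} {φ : (Fin d → ℝ) → ℝ} {t : ℝ}

/-- The union of the cells of side length `1 / M` on which the average of `φ` exceeds `t`. -/
def highCells (φ : (Fin d → ℝ) → ℝ) (M : ℕ) (t : ℝ) : Set (Fin d → ℝ) :=
  ⋃ m ∈ {m : Fin d → Fin M | t < ⨍ z in gridCell m, φ z}, gridCell m

lemma measurableSet_gridCell (m : Fin d → Fin M) : MeasurableSet (gridCell m) :=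
  measurableSet_closedCube _ _

lemma highCells_subset_Icc (φ : (Fin d → ℝ) → ℝ) (M : ℕ) (t : ℝ) :
    highCells φ M t ⊆ Set.Icc 0 1 :=
  Set.iUnion₂_subset fun m _ => gridCell_subset_Icc m

lemma measurableSet_highCells (φ : (Fin d → ℝ) → ℝ) (M : ℕ) (t : ℝ) :
    MeasurableSet (highCells φ M t) :=
  (Set.toFinite _).measurableSet_biUnion fun m _ => measurableSet_gridCell m

lemma volume_gridCell_inter_of_ne {m m' : Fin d → Fin M} (hm : m ≠ m') :
    volume (gridCell m ∩ gridCell m') = 0 := by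
  obtain ⟨i, hi⟩ := Function.ne_iff.1 hm
  wlog hlt : m i < m' i generalizing m m'
  · rw [Set.inter_comm]
    exact this hm.symm hi.symm (lt_of_le_of_ne (not_lt.1 hlt) hi.symm)
  have hM : (0 : ℝ) < M := by exact_mod_cast (m i).pos
  refine measure_mono_null (t := {x | x i = gridPoint m' i}) (fun x ⟨hx, hx'⟩ => ?_) ?_
  · have hm' : ((m i : ℕ) : ℝ) + 1 ≤ (m' i : ℕ) := by exact_mod_cast hlt
    refine le_antisymm ((hx.2 i).trans ?_) (hx'.1 i)
    simp only [gridPoint, ← one_div, ← add_div]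
    gcongr
  · exact Measure.pi_hyperplane (fun _ => volume) i _

lemma sum_setIntegral_gridCell_le (hφ : IntegrableOn φ (Set.Icc 0 1)) (h0 : ∀ x, 0 ≤ φ x) :
    ∑ m : Fin d → Fin M, ∫ x in gridCell m, φ x ≤ ∫ x, φ x ∂torusMeasure d := by
  have hsub : (⋃ m : Fin d → Fin M, gridCell m) ⊆ Set.Icc 0 1 :=
    Set.iUnion_subset fun m => gridCell_subset_Icc m
  rw [← tsum_fintype (L := .unconditional _), ← integral_iUnion_ae
    (fun m => (measurableSet_gridCell m).nullMeasurableSet)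
    (fun m m' hm => volume_gridCell_inter_of_ne hm) (hφ.mono_set hsub)]
  exact setIntegral_mono_set hφ (.of_forall h0) hsub.eventuallyLE

lemma integrableOn_indicator_lt (hφ : Continuous φ) (t : ℝ) {K : Set (Fin d → ℝ)}
    (hK : IsCompact K) : IntegrableOn ({x | t < 2 * φ x}.indicator φ) K :=
  (hφ.continuousOn.integrableOn_compact hK).indicator
    (measurableSet_lt measurable_const (hφ.measurable.const_mul 2))

lemma mul_volumeReal_gridCell_le (hφ : Continuous φ) {m : Fin d → Fin M} (ht0 : 0 ≤ t)
    (ht : t < ⨍ z in gridCell m, φ z) :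
    t * volume.real (gridCell m) ≤ 2 * ∫ x in gridCell m, {x | t < 2 * φ x}.indicator φ x := by
  have hcell : IsCompact (gridCell m) := isCompact_closedCube _ _
  have setIntegral_eq :
      ∫ x in gridCell m, φ x = volume.real (gridCell m) * ⨍ z in gridCell m, φ z := by
    rw [← smul_eq_mul, measure_smul_setAverage _ hcell.measure_lt_top.ne]
  have setIntegral_le : ∫ x in gridCell m, φ x
      ≤ ∫ x in gridCell m, ({x | t < 2 * φ x}.indicator φ x + t / 2) := by
    refine setIntegral_mono (hφ.continuousOn.integrableOn_compact hcell)
      ((integrableOn_indicator_lt hφ t hcell).add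
        (continuousOn_const.integrableOn_compact hcell)) fun x => ?_
    by_cases hx : t < 2 * φ x
    · rw [Set.indicator_of_mem (by exact hx)]
      linarith
    · rw [Set.indicator_of_notMem (by exact hx)]
      linarith
  rw [integral_add (integrableOn_indicator_lt hφ t hcell)
    (continuousOn_const.integrableOn_compact hcell), setIntegral_const,
    smul_eq_mul] at setIntegral_le
  have := mul_le_mul_of_nonneg_left ht.le (measureReal_nonneg (μ := volume) (s := gridCell m))
  linarith

/-- On a cell of large average, the part of `φ` below half the threshold contributes at most half
the threshold to that average. -/
lemma mul_volumeReal_highCells_le (hφ : Continuous φ) (h0 : ∀ x, 0 ≤ φ x) (M : ℕ) (ht : 0 ≤ t) :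
    t * volume.real (highCells φ M t)
      ≤ 2 * ∫ x, {x | t < 2 * φ x}.indicator φ x ∂torusMeasure d := by
  classical
  have indicator_nonneg (x : Fin d → ℝ) : 0 ≤ {x | t < 2 * φ x}.indicator φ x :=
    Set.indicator_nonneg (fun x _ => h0 x) x
  let S := Finset.univ.filter fun m : Fin d → Fin M => t < ⨍ z in gridCell m, φ z
  have highCells_eq : highCells φ M t = ⋃ m ∈ S, gridCell m := by simp [S, highCells]
  calc t * volume.real (highCells φ M t)
      ≤ t * ∑ m ∈ S, volume.real (gridCell m) := by
        rw [highCells_eq]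
        gcongr
        exact measureReal_biUnion_finset_le _ _
    _ ≤ ∑ m ∈ S, 2 * ∫ x in gridCell m, {x | t < 2 * φ x}.indicator φ x := by
        rw [Finset.mul_sum]
        refine Finset.sum_le_sum fun m hm => ?_
        exact mul_volumeReal_gridCell_le hφ ht (Finset.mem_filter.1 hm).2
    _ ≤ 2 * ∑ m : Fin d → Fin M, ∫ x in gridCell m, {x | t < 2 * φ x}.indicator φ x := by
        rw [← Finset.mul_sum]
        gcongr
        · exact fun m _ _ => setIntegral_nonneg (measurableSet_gridCell m) fun x _ =>
            indicator_nonneg x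
        · exact S.subset_univ
    _ ≤ _ := by
        gcongr
        exact sum_setIntegral_gridCell_le (integrableOn_indicator_lt hφ t isCompact_Icc)
          indicator_nonneg

lemma sum_geometric_ite_lt_le {σ q G : ℝ} (hσ : 0 ≤ σ) (hq : 1 < q) (hG : 0 ≤ G) (J : ℕ) :
    ∑ j ∈ Finset.range J, (if σ * q ^ j < G then σ * q ^ j else 0) ≤ q / (q - 1) * G := by
  have hq' : 0 < q - 1 := by linarith
  induction J with
  | zero => simpa using by positivity
  | succ n ih =>
    rw [Finset.sum_range_succ]
    split_ifs with h
    · have sum_le : ∑ j ∈ Finset.range n, (if σ * q ^ j < G then σ * q ^ j else 0)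
          ≤ (σ * q ^ n) / (q - 1) := by
        calc _ ≤ ∑ j ∈ Finset.range n, σ * q ^ j := by
              gcongr
              split_ifs
              · rfl
              · positivity
          _ = σ * (q ^ n - 1) / (q - 1) := by
              rw [← Finset.mul_sum, geom_sum_eq hq.ne', mul_div_assoc]
          _ ≤ _ := by gcongr; linarith
      calc _ ≤ G / (q - 1) + G := by
            refine add_le_add (sum_le.trans ?_) h.le
            gcongr
        _ = q / (q - 1) * G := by field_simp; ring
    · simpa using ih

lemma sum_rpow_mul_volumeReal_highCells_le (hφ : Continuous φ) (h0 : ∀ x, 0 ≤ φ x) {β lam : ℝ}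
    (hβ : 0 < β) (hlam : 1 < lam) (ht : 0 < t) (M : ℕ → ℕ) (J : ℕ) :
    ∑ j ∈ Finset.range J, (t * lam ^ j) ^ (1 + β) * volume.real (highCells φ (M j) (t * lam ^ j))
      ≤ 2 * (lam ^ β / (lam ^ β - 1) * 2 ^ β) * ∫ x, φ x ^ (1 + β) ∂torusMeasure d := by
  have hlam0 : 0 < lam := one_pos.trans hlam
  have hq : 1 < lam ^ β := Real.one_lt_rpow hlam hβ
  let G (j : ℕ) : (Fin d → ℝ) → ℝ := {x | t * lam ^ j < 2 * φ x}.indicator φ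
  have hG (j : ℕ) : Integrable (G j) (torusMeasure d) :=
    integrableOn_indicator_lt hφ _ isCompact_Icc
  have hGsum : Integrable (fun x => ∑ j ∈ Finset.range J, (t * lam ^ j) ^ β * G j x)
      (torusMeasure d) := integrable_finsetSum _ fun j _ => (hG j).const_mul _
  have sum_mul_le (x : Fin d → ℝ) : ∑ j ∈ Finset.range J, (t * lam ^ j) ^ β * G j x
      ≤ lam ^ β / (lam ^ β - 1) * 2 ^ β * φ x ^ (1 + β) := by
    have rpow_eq (j : ℕ) : (t * lam ^ j) ^ β = t ^ β * (lam ^ β) ^ j := by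
      rw [Real.mul_rpow ht.le (by positivity), Real.rpow_pow_comm hlam0.le]
    have mul_indicator_eq (j : ℕ) : (t * lam ^ j) ^ β * G j x
        = (if t ^ β * (lam ^ β) ^ j < (2 * φ x) ^ β then t ^ β * (lam ^ β) ^ j else 0) * φ x := by
      rw [← rpow_eq]
      simp only [G, Set.indicator_apply, Set.mem_ofPred_eq, mul_ite, ite_mul, mul_zero, zero_mul,
        Real.rpow_lt_rpow_iff (show 0 ≤ t * lam ^ j by positivity)
          (show 0 ≤ 2 * φ x by linarith [h0 x]) hβ]
    simp only [mul_indicator_eq, ← Finset.sum_mul]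
    calc _ ≤ lam ^ β / (lam ^ β - 1) * (2 * φ x) ^ β * φ x := by
          refine mul_le_mul_of_nonneg_right ?_ (h0 x)
          exact sum_geometric_ite_lt_le (by positivity) hq
            (Real.rpow_nonneg (by linarith [h0 x]) _) J
      _ = _ := by
          rw [Real.mul_rpow zero_le_two (h0 x), Real.rpow_add_of_nonneg (h0 x) zero_le_one hβ.le,
            Real.rpow_one]
          ring
  calc _ ≤ ∑ j ∈ Finset.range J, 2 * ∫ x, (t * lam ^ j) ^ β * G j x ∂torusMeasure d := by
        refine Finset.sum_le_sum fun j _ => ?_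
        rw [Real.rpow_add_of_nonneg (by positivity) zero_le_one hβ.le, Real.rpow_one,
          integral_const_mul, mul_comm (t * lam ^ j), mul_assoc, mul_left_comm 2]
        refine mul_le_mul_of_nonneg_left ?_ (by positivity)
        exact mul_volumeReal_highCells_le hφ h0 _ (by positivity)
    _ = 2 * ∫ x, ∑ j ∈ Finset.range J, (t * lam ^ j) ^ β * G j x ∂torusMeasure d := by
        rw [integral_finsetSum _ fun j _ => (hG j).const_mul _, Finset.mul_sum]
    _ ≤ 2 * ∫ x, lam ^ β / (lam ^ β - 1) * 2 ^ β * φ x ^ (1 + β) ∂torusMeasure d := by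
        refine mul_le_mul_of_nonneg_left (integral_mono hGsum ?_ sum_mul_le) zero_le_two
        exact ((hφ.rpow_const fun _ => Or.inr (by linarith)).const_mul _).continuousOn
          |>.integrableOn_compact isCompact_Icc
    _ = _ := by rw [integral_const_mul, mul_assoc 2]

end HighCells

/-! ### From local bounds to uniform and integral bounds -/

section LocalBound

variable {d k M N : ℕ} {K C₀ r b R : ℝ} {v g : (Fin d → ℝ) → ℝ}

lemma cubeAvg_le_sqrt_setAverage_sq {a : Fin d → ℝ} {h : ℝ} (hh : 0 < h) (hg : Continuous g)
    (h0 : ∀ x, 0 ≤ g x) (hr : 0 < r) (hr2 : r ≤ 2) :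
    cubeAvg g r a h ≤ Real.sqrt (⨍ x in closedCube a h, g x ^ 2) := by
  have rpow_rpow_eq (x : Fin d → ℝ) : (g x ^ r) ^ (2 / r) = g x ^ 2 := by
    rw [← Real.rpow_mul (h0 x), mul_div_cancel₀ _ hr.ne', Real.rpow_two]
  have jensen := setAverage_le_cubeAvg (b := a) hh (hg.rpow_const fun _ => Or.inr hr.le)
    (fun x => Real.rpow_nonneg (h0 x) r) (one_le_div hr |>.2 hr2)
  simp only [cubeAvg, rpow_rpow_eq, one_div_div] at jensen
  calc cubeAvg g r a h ≤ ((⨍ x in closedCube a h, g x ^ 2) ^ (r / 2)) ^ (1 / r) :=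
        Real.rpow_le_rpow (setAverage_rpow_nonneg h0 r _) jensen (by positivity)
    _ = Real.sqrt (⨍ x in closedCube a h, g x ^ 2) := by
        rw [← Real.rpow_mul (setAverage_nonneg _ _ fun x => sq_nonneg (g x)), Real.sqrt_eq_rpow]
        congr 1
        field_simp

/-- `v` obeys, at every scale `1 / M ≥ C₀ / N`, the local estimate with noise level `b` and with
derivative bound `g`, where `g` has `L²` norm at most `R`. -/
structure HasLocalBound (K C₀ : ℝ) (k : ℕ) (r : ℝ) (N : ℕ) (b R : ℝ) (v g : (Fin d → ℝ) → ℝ) :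
    Prop where
  continuous : Continuous g
  nonneg : ∀ x, 0 ≤ g x
  integral_sq_le : ∫ x, g x ^ 2 ∂torusMeasure d ≤ R ^ 2
  abs_le : ∀ M : ℕ, 0 < M → C₀ * M ≤ N → ∀ m : Fin d → Fin M, ∀ y ∈ gridCell m,
    |v y| ≤ K * (b * Real.sqrt ((M : ℝ) ^ d)
      + ((M : ℝ) ^ k)⁻¹ * cubeAvg g r (gridPoint m) (M : ℝ)⁻¹)

namespace HasLocalBound

lemma cubeAvg_gridCell_le (H : HasLocalBound K C₀ k r N b R v g) (hr : 0 < r) (hr2 : r ≤ 2)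
    (hR : 0 ≤ R) (hM : 0 < M) (m : Fin d → Fin M) :
    cubeAvg g r (gridPoint m) (M : ℝ)⁻¹ ≤ Real.sqrt ((M : ℝ) ^ d) * R := by
  have hM' : (0 : ℝ) < (M : ℝ)⁻¹ := by positivity
  have integral_le : ∫ x in gridCell m, g x ^ 2 ≤ R ^ 2 :=
    (setIntegral_mono_set ((H.continuous.pow 2).continuousOn.integrableOn_compact isCompact_Icc)
      (.of_forall fun x => sq_nonneg (g x)) (gridCell_subset_Icc m).eventuallyLE).trans
      H.integral_sq_le
  refine (cubeAvg_le_sqrt_setAverage_sq hM' H.continuous H.nonneg hr hr2).trans ?_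
  rw [setAverage_closedCube _ _ hM'.le, smul_eq_mul, inv_pow, inv_inv, ← Real.sqrt_sq hR,
    ← Real.sqrt_mul (by positivity)]
  gcongr
  exact integral_le

lemma abs_le_of_cubeAvg_le (H : HasLocalBound K C₀ k r N b R v g) (hK : 0 ≤ K) (hM : 0 < M)
    (hMN : C₀ * M ≤ N) {m : Fin d → Fin M} {y : Fin d → ℝ} (hy : y ∈ gridCell m) {D : ℝ}
    (hD : cubeAvg g r (gridPoint m) (M : ℝ)⁻¹ ≤ D * (b * (M : ℝ) ^ k * Real.sqrt ((M : ℝ) ^ d))) :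
    |v y| ≤ K * (1 + D) * (b * Real.sqrt ((M : ℝ) ^ d)) := by
  refine (H.abs_le M hM hMN m y hy).trans ?_
  rw [mul_assoc]
  gcongr
  have hM' : (0 : ℝ) < (M : ℝ) ^ k := by positivity
  have := (inv_mul_le_iff₀ hM').2 (hD.trans_eq (by ring :
    _ = (M : ℝ) ^ k * (D * (b * Real.sqrt ((M : ℝ) ^ d)))))
  linarith

lemma abs_le_of_le_mul_pow (H : HasLocalBound K C₀ k r N b R v g) (hK : 0 ≤ K) (hr : 0 < r)
    (hr2 : r ≤ 2) (hR : 0 ≤ R) (hM : 0 < M) (hMN : C₀ * M ≤ N) {D : ℝ}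
    (hRM : R ≤ b * (D * M) ^ k) {y : Fin d → ℝ} (hy : y ∈ Set.Icc 0 1) :
    |v y| ≤ K * (1 + D ^ k) * (b * Real.sqrt ((M : ℝ) ^ d)) := by
  obtain ⟨m, hm⟩ := exists_mem_gridCell hM hy
  refine H.abs_le_of_cubeAvg_le hK hM hMN hm ((H.cubeAvg_gridCell_le hr hr2 hR hM m).trans ?_)
  calc Real.sqrt ((M : ℝ) ^ d) * R ≤ Real.sqrt ((M : ℝ) ^ d) * (b * (D * M) ^ k) := by gcongr
    _ = D ^ k * (b * (M : ℝ) ^ k * Real.sqrt ((M : ℝ) ^ d)) := by rw [mul_pow]; ring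

lemma abs_le_of_notMem_highCells (H : HasLocalBound K C₀ k r N b R v g) (hK : 0 ≤ K) (hr : 0 < r)
    (hb : 0 ≤ b) (hM : 0 < M) (hMN : C₀ * M ≤ N) {y : Fin d → ℝ} (hy : y ∈ Set.Icc 0 1)
    (hy' : y ∉ highCells (fun x => g x ^ r) M ((b * (M : ℝ) ^ k * Real.sqrt ((M : ℝ) ^ d)) ^ r)) :
    |v y| ≤ K * 2 * (b * Real.sqrt ((M : ℝ) ^ d)) := by
  obtain ⟨m, hm⟩ := exists_mem_gridCell hM hy
  have average_le : ⨍ x in gridCell m, g x ^ r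
      ≤ (b * (M : ℝ) ^ k * Real.sqrt ((M : ℝ) ^ d)) ^ r :=
    not_lt.1 fun hlt => hy' (Set.mem_biUnion hlt hm)
  have cubeAvg_le : cubeAvg g r (gridPoint m) (M : ℝ)⁻¹
      ≤ b * (M : ℝ) ^ k * Real.sqrt ((M : ℝ) ^ d) := by
    rw [cubeAvg, one_div, Real.rpow_inv_le_iff_of_pos (setAverage_rpow_nonneg H.nonneg r _)
      (by positivity) hr]
    exact average_le
  rw [← one_add_one_eq_two]
  exact H.abs_le_of_cubeAvg_le hK hM hMN hm (cubeAvg_le.trans_eq (one_mul _).symm)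

end HasLocalBound

lemma exists_two_pow_scale {X : ℝ} (hC₀ : 1 ≤ C₀) (hX : 1 ≤ X) (hXN : X ≤ N) (hN : C₀ ≤ N) :
    ∃ J : ℕ, C₀ * 2 ^ J ≤ N ∧ 2 ^ J ≤ X ∧ X ≤ 2 * C₀ * 2 ^ J := by
  have hC₀' : 0 < C₀ := by linarith
  rcases le_total C₀ X with h | h
  · obtain ⟨J, hJ, hJ'⟩ := exists_nat_pow_near ((one_le_div hC₀').2 h) one_lt_two
    rw [le_div_iff₀ hC₀'] at hJ
    rw [div_lt_iff₀ hC₀', pow_succ] at hJ'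
    exact ⟨J, by linarith, (le_mul_of_one_le_right (by positivity) hC₀).trans hJ, by linarith⟩
  · exact ⟨0, by simpa using hN, by simpa using hX, by simpa using by linarith⟩

namespace HasLocalBound

/-- The scale `2 ^ J` is comparable to `(R / b) ^ (1 / k)`, where noise and smoothness balance. -/
lemma exists_abs_le (H : HasLocalBound K C₀ k r N b R v g) (hK : 0 ≤ K) (hC₀ : 1 ≤ C₀)
    (hN : C₀ ≤ N) (hr : 0 < r) (hr2 : r ≤ 2) (hk : k ≠ 0) (hb : 0 < b) (hbR : b ≤ R)
    (hRN : R ≤ b * (N : ℝ) ^ k) :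
    ∃ J : ℕ, C₀ * 2 ^ J ≤ N ∧ 2 ^ J ≤ (R / b) ^ (k⁻¹ : ℝ) ∧ ∀ y ∈ Set.Icc (0 : Fin d → ℝ) 1,
      |v y| ≤ K * (1 + (2 * C₀) ^ k) * (b * Real.sqrt ((2 ^ J) ^ d)) := by
  have hRb : 1 ≤ R / b := (one_le_div hb).2 hbR
  set X : ℝ := (R / b) ^ (k⁻¹ : ℝ)
  have scale_pow : X ^ k = R / b :=
    Real.rpow_inv_natCast_pow (by positivity) hk
  obtain ⟨J, hJN, hJX, hXJ⟩ := exists_two_pow_scale (N := N) (X := X) hC₀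
    (Real.one_le_rpow hRb (by positivity))
    (le_of_pow_le_pow_left₀ hk (by positivity)
      (by rw [scale_pow]; exact (div_le_iff₀' hb).2 hRN)) hN
  refine ⟨J, hJN, hJX, fun y hy => ?_⟩
  have R_le : R ≤ b * (2 * C₀ * (2 ^ J : ℕ)) ^ k := by
    rw [← div_le_iff₀' hb, ← scale_pow]
    push_cast
    gcongr
  simpa using H.abs_le_of_le_mul_pow hK hr hr2 (hb.le.trans hbR) (M := 2 ^ J) (by positivity)
    (by simpa using hJN) R_le hy

lemma abs_le_rpow (H : HasLocalBound K C₀ k r N b R v g) (hK : 0 ≤ K) (hC₀ : 1 ≤ C₀)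
    (hN : C₀ ≤ N) (hr : 0 < r) (hr2 : r ≤ 2) (hk : k ≠ 0) (hb : 0 < b) (hbR : b ≤ R)
    (hRN : R ≤ b * (N : ℝ) ^ k) {y : Fin d → ℝ} (hy : y ∈ Set.Icc 0 1) :
    |v y| ≤ K * (1 + (2 * C₀) ^ k) * (b ^ (1 - d / (2 * k) : ℝ) * R ^ (d / (2 * k) : ℝ)) := by
  have hR : 0 < R := hb.trans_le hbR
  obtain ⟨J, -, hJ, hv⟩ := H.exists_abs_le hK hC₀ hN hr hr2 hk hb hbR hRN
  refine (hv y hy).trans (mul_le_mul_of_nonneg_left ?_ (by positivity))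
  calc b * Real.sqrt ((2 ^ J) ^ d) ≤ b * Real.sqrt (((R / b) ^ (k⁻¹ : ℝ)) ^ d) := by gcongr
    _ = b * (R / b) ^ (d / (2 * k) : ℝ) := by
        rw [Real.sqrt_eq_rpow, ← Real.rpow_mul_natCast (by positivity), ← Real.rpow_mul
          (by positivity)]
        congr 2
        field_simp
    _ = b ^ (1 - d / (2 * k) : ℝ) * R ^ (d / (2 * k) : ℝ) := by
        rw [Real.div_rpow hR.le hb.le, Real.rpow_sub hb, Real.rpow_one]
        ring

lemma exists_abs_rpow_le_add_sum (H : HasLocalBound K C₀ k r N b R v g) (hK : 0 ≤ K)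
    (hC₀ : 1 ≤ C₀) (hN : C₀ ≤ N) (hr : 0 < r) (hr2 : r ≤ 2) (hk : k ≠ 0) (hb : 0 < b)
    (hbR : b ≤ R) (hRN : R ≤ b * (N : ℝ) ^ k) {p : ℝ} (hp : 0 ≤ p) {C : ℝ}
    (hC : C = K * (1 + (2 * C₀) ^ k)) :
    ∃ J : ℕ, ∀ y ∈ Set.Icc (0 : Fin d → ℝ) 1, |v y| ^ p ≤ (C * b) ^ p + ∑ j ∈ Finset.range J,
      (highCells (fun x => g x ^ r) (2 ^ j)
        ((b * (2 ^ j) ^ k * Real.sqrt ((2 ^ j) ^ d)) ^ r)).indicator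
        (fun _ => (C * (b * Real.sqrt ((2 ^ (j + 1)) ^ d))) ^ p) y := by
  obtain ⟨J, hJN, -, hJ⟩ := H.exists_abs_le hK hC₀ hN hr hr2 hk hb hbR hRN
  have two_mul_le : K * 2 ≤ C := by
    have : 1 ≤ (2 * C₀) ^ k := one_le_pow₀ (by linarith)
    rw [hC]
    gcongr
    linarith
  have hC0 : 0 ≤ C := by linarith
  rw [← hC] at hJ
  refine ⟨J, fun y hy => ?_⟩
  have indicator_nonneg : ∀ j ∈ Finset.range J, 0 ≤ (highCells (fun x => g x ^ r) (2 ^ j)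
      ((b * (2 ^ j) ^ k * Real.sqrt ((2 ^ j) ^ d)) ^ r)).indicator
      (fun _ => (C * (b * Real.sqrt ((2 ^ (j + 1)) ^ d))) ^ p) y := fun j _ =>
    Set.indicator_nonneg (fun _ _ => by positivity) y
  classical
  have good_scale : ∃ j, |v y| ≤ C * (b * Real.sqrt ((2 ^ j) ^ d)) := ⟨J, hJ y hy⟩
  have hfind := Nat.find_spec good_scale
  rcases hcase : Nat.find good_scale with _ | j <;> rw [hcase] at hfind
  · refine le_add_of_le_of_nonneg (Real.rpow_le_rpow (abs_nonneg _) ?_ hp)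
      (Finset.sum_nonneg indicator_nonneg)
    simpa using hfind
  · have hjJ : j < J := by
      have := Nat.find_min' good_scale (hJ y hy)
      omega
    have mem_highCells : y ∈ highCells (fun x => g x ^ r) (2 ^ j)
        ((b * (2 ^ j) ^ k * Real.sqrt ((2 ^ j) ^ d)) ^ r) := by
      by_contra hy'
      have scale_le : C₀ * (2 ^ j : ℕ) ≤ N := by
        push_cast
        exact le_trans (by gcongr; exact one_le_two) hJN
      have := H.abs_le_of_notMem_highCells hK hr hb.le (by positivity) scale_le hy
        (by simpa using hy')
      push_cast at this
      exact Nat.find_min good_scale (m := j) (by omega) (this.trans (by gcongr))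
    refine le_add_of_nonneg_of_le (by positivity)
      (le_trans ?_ (Finset.single_le_sum indicator_nonneg (Finset.mem_range.2 hjJ)))
    rw [Set.indicator_of_mem mem_highCells]
    exact Real.rpow_le_rpow (abs_nonneg _) hfind hp

end HasLocalBound

/-- The exponent `q` at which the two regimes of the rate `ϑ` meet. -/
def critExp (k d : ℕ) : ℝ :=
  (4 * k + 2 * d) / d

lemma two_lt_critExp (hd : d ≠ 0) (hk : k ≠ 0) : 2 < critExp k d := by
  rw [critExp, lt_div_iff₀ (by positivity)]
  have : (0 : ℝ) < k := by positivity
  linarith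

lemma sqrt_pow_rpow_critExp (hd : d ≠ 0) (k : ℕ) {x : ℝ} (hx : 0 ≤ x) :
    Real.sqrt (x ^ d) ^ critExp k d = (x ^ k) ^ 2 * x ^ d := by
  rw [Real.sqrt_eq_rpow, ← Real.rpow_natCast_mul hx, ← Real.rpow_mul hx, ← pow_mul, ← pow_add,
    ← Real.rpow_natCast, critExp]
  congr 1
  push_cast
  field_simp
  ring

lemma rpow_critExp_eq_mul_rpow (hd : d ≠ 0) (k j : ℕ) {A : ℝ} (hA : 0 ≤ A) (hb : 0 < b)
    (hr : r ≠ 0) :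
    (A * (b * Real.sqrt ((2 ^ (j + 1)) ^ d))) ^ critExp k d
      = A ^ critExp k d * 2 ^ (2 * k + d) * b ^ (critExp k d - 2)
        * ((b * (2 ^ j) ^ k * Real.sqrt ((2 ^ j) ^ d)) ^ r) ^ (2 / r) := by
  rw [← Real.rpow_mul (by positivity), mul_div_cancel₀ _ hr, Real.rpow_two, mul_pow,
    Real.sq_sqrt (by positivity), Real.mul_rpow hA (by positivity),
    Real.mul_rpow hb.le (by positivity), sqrt_pow_rpow_critExp hd k (by positivity),
    Real.rpow_sub hb, Real.rpow_two]
  field_simp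
  ring

lemma two_pow_threshold_rpow_eq (hb : 0 ≤ b) (r : ℝ) (j : ℕ) :
    (b * (2 ^ j) ^ k * Real.sqrt ((2 ^ j) ^ d)) ^ r
      = b ^ r * ((2 ^ k * Real.sqrt (2 ^ d)) ^ r) ^ j := by
  have sqrt_eq : Real.sqrt ((2 ^ j) ^ d) = Real.sqrt (2 ^ d) ^ j := by
    rw [pow_right_comm, Real.sqrt_eq_rpow, Real.sqrt_eq_rpow, Real.rpow_pow_comm (by positivity)]
  rw [sqrt_eq, pow_right_comm, mul_assoc, ← mul_pow, Real.mul_rpow hb (by positivity),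
    Real.rpow_pow_comm (by positivity)]

lemma integral_le_add_sum_mul_volumeReal {f : (Fin d → ℝ) → ℝ} (hf : Integrable f (torusMeasure d))
    {ι : Type*} {s : Finset ι} {E : ι → Set (Fin d → ℝ)} (hE : ∀ j, MeasurableSet (E j))
    (hE' : ∀ j, E j ⊆ Set.Icc 0 1) {a : ℝ} {w : ι → ℝ}
    (h : ∀ x ∈ Set.Icc (0 : Fin d → ℝ) 1, f x ≤ a + ∑ j ∈ s, (E j).indicator (fun _ => w j) x) :
    ∫ x, f x ∂torusMeasure d ≤ a + ∑ j ∈ s, w j * volume.real (E j) := by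
  have hint (j : ι) : Integrable ((E j).indicator fun _ => w j) (torusMeasure d) :=
    (integrable_const _).indicator (hE j)
  have real_eq (j : ι) : (torusMeasure d).real (E j) = volume.real (E j) := by
    rw [torusMeasure, measureReal_restrict_apply (hE j), Set.inter_eq_left.2 (hE' j)]
  calc ∫ x, f x ∂torusMeasure d
      ≤ ∫ x, (a + ∑ j ∈ s, (E j).indicator (fun _ => w j) x) ∂torusMeasure d :=
        integral_mono_ae hf ((integrable_const a).add (integrable_finsetSum _ fun j _ => hint j))
          (ae_restrict_of_forall_mem measurableSet_Icc h)
    _ = a + ∑ j ∈ s, w j * volume.real (E j) := by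
        rw [integral_add (integrable_const a) (integrable_finsetSum _ fun j _ => hint j),
          integral_finsetSum _ fun j _ => hint j]
        simp [integral_indicator_const _ (hE _), real_eq, mul_comm]

/-- Each bad set carries a power of the threshold that Chebyshev's inequality turns into a
truncation of `g ^ 2`; the truncations at geometrically growing thresholds sum up. -/
theorem HasLocalBound.exists_integral_rpow_critExp_le (hd : d ≠ 0) (hk : k ≠ 0) (hK : 0 ≤ K)
    (hC₀ : 1 ≤ C₀) (hr : 0 < r) (hr2 : r < 2) :
    ∃ C, 0 ≤ C ∧ ∀ {N : ℕ} {b R : ℝ} {v g : (Fin d → ℝ) → ℝ}, HasLocalBound K C₀ k r N b R v g →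
      Continuous v → C₀ ≤ N → 0 < b → b ≤ R → R ≤ b * (N : ℝ) ^ k →
      ∫ x, |v x| ^ critExp k d ∂torusMeasure d ≤ C * (b ^ (critExp k d - 2) * R ^ 2) := by
  set p := critExp k d
  have hp2 : 2 < p := two_lt_critExp hd hk
  have hβ : 0 < 2 / r - 1 := sub_pos.2 ((one_lt_div hr).2 hr2)
  set ρ : ℝ := 2 ^ k * Real.sqrt (2 ^ d)
  have hρ : 1 < ρ := one_lt_mul_of_lt_of_le (one_lt_pow₀ one_lt_two hk)
    (Real.one_le_sqrt.2 (one_le_pow₀ one_le_two))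
  have hρr : 1 < ρ ^ r := Real.one_lt_rpow hρ hr
  set A := K * (1 + (2 * C₀) ^ k) with hA
  set S : ℝ := 2 * ((ρ ^ r) ^ (2 / r - 1) / ((ρ ^ r) ^ (2 / r - 1) - 1) * 2 ^ (2 / r - 1))
  have hS : 0 ≤ S := by
    have := sub_pos.2 (Real.one_lt_rpow hρr hβ)
    positivity
  refine ⟨A ^ p * (1 + 2 ^ (2 * k + d) * S), by positivity, ?_⟩
  intro N b R v g H hv hN hb hbR hRN
  obtain ⟨J, hJ⟩ := H.exists_abs_rpow_le_add_sum hK hC₀ hN hr hr2.le hk hb hbR hRN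
    (p := p) (by linarith) hA
  simp only [p, rpow_critExp_eq_mul_rpow hd k _ (show 0 ≤ A by positivity) hb hr.ne',
    two_pow_threshold_rpow_eq hb.le] at hJ
  have sum_le := sum_rpow_mul_volumeReal_highCells_le
    (H.continuous.rpow_const fun _ => Or.inr hr.le)
    (fun x => Real.rpow_nonneg (H.nonneg x) r) hβ hρr (Real.rpow_pos_of_pos hb r) (2 ^ ·) J
  simp only [add_sub_cancel, ← Real.rpow_mul (H.nonneg _), mul_div_cancel₀ _ hr.ne',
    Real.rpow_two] at sum_le
  have hint : Integrable (fun x => |v x| ^ p) (torusMeasure d) :=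
    (hv.abs.rpow_const fun _ => Or.inr (by linarith)).continuousOn.integrableOn_compact
      isCompact_Icc
  have rpow_le : b ^ p ≤ b ^ (p - 2) * R ^ 2 := by
    rw [← sub_add_cancel p 2, Real.rpow_add hb, add_sub_cancel_right, Real.rpow_two]
    gcongr
  refine (integral_le_add_sum_mul_volumeReal hint (fun j => measurableSet_highCells _ _ _)
    (fun j => highCells_subset_Icc _ _ _) hJ).trans ?_
  simp only [mul_assoc, ← Finset.mul_sum]
  calc _ ≤ A ^ p * (b ^ (p - 2) * R ^ 2)
        + A ^ p * (2 ^ (2 * k + d) * (b ^ (p - 2) * (S * R ^ 2))) := by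
        rw [Real.mul_rpow (by positivity) hb.le]
        gcongr
        exact sum_le.trans (mul_le_mul_of_nonneg_left H.integral_sq_le hS)
    _ = _ := by ring

end LocalBound

/-! ### The interpolation inequality for smooth functions -/

lemma eLpNorm_le_rpow_mul_eLpNorm_top_rpow {Ω E : Type*} [MeasurableSpace Ω]
    [NormedAddCommGroup E] {μ : Measure Ω} {f : Ω → E} (hf : AEStronglyMeasurable f μ) (q : ℝ≥0∞)
    {s : ℝ} (hs : 0 < s) (hs1 : s < 1) :
    eLpNorm f q μ ≤ eLpNorm f (q * ENNReal.ofReal s) μ ^ s * eLpNorm f ∞ μ ^ (1 - s) := by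
  have hs1' : 0 < 1 - s := by linarith
  have norm_eq : (fun x => ‖f x‖) = (fun x => ‖f x‖ ^ (1 - s)) • fun x => ‖f x‖ ^ s := by
    ext x
    rw [Pi.smul_apply', smul_eq_mul, ← Real.rpow_add' (norm_nonneg _) (by norm_num),
      sub_add_cancel, Real.rpow_one]
  calc eLpNorm f q μ = eLpNorm ((fun x => ‖f x‖ ^ (1 - s)) • fun x => ‖f x‖ ^ s) q μ := by
        rw [← norm_eq, eLpNorm_norm]
    _ ≤ eLpNorm (fun x => ‖f x‖ ^ (1 - s)) ∞ μ * eLpNorm (fun x => ‖f x‖ ^ s) q μ :=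
        eLpNorm_smul_le_eLpNorm_top_mul_eLpNorm q
          (hf.norm.aemeasurable.pow_const s).aestronglyMeasurable _
    _ = _ := by
        rw [eLpNorm_norm_rpow f hs1', eLpNorm_norm_rpow f hs,
          ENNReal.top_mul (by simpa using hs1), mul_comm]

section SmoothInterpolation

variable {k d : ℕ} {q : ℝ≥0∞} {b R : ℝ} {v : (Fin d → ℝ) → ℝ}

lemma one_sub_two_mul_theta_of_le (hd : d ≠ 0) (hq : q ≤ ENNReal.ofReal (critExp k d)) :
    1 - 2 * theta k d q = d / (2 * k + d) := by
  rw [theta, if_pos (by simpa only [critExp] using hq)]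
  field_simp
  ring

lemma one_sub_two_mul_theta_of_lt (hk : k ≠ 0) (hq : ENNReal.ofReal (critExp k d) < q) :
    1 - 2 * theta k d q = d / (2 * k) - d / k * q.toReal⁻¹ := by
  rw [theta, if_neg (by simpa only [critExp] using not_le.2 hq), ENNReal.toReal_inv]
  field_simp
  ring

lemma theta_pos (hd : d ≠ 0) (hk : d < 2 * k) (q : ℝ≥0∞) : 0 < theta k d q := by
  have hk' : (d : ℝ) < 2 * k := mod_cast hk
  have hd' : (0 : ℝ) < d := by positivity
  rw [theta]
  split_ifs
  · exact div_pos (by linarith) (by positivity)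
  · have : 0 ≤ d * (q⁻¹).toReal := by positivity
    exact div_pos (by linarith) (by linarith)

lemma one_sub_two_mul_theta_nonneg (hd : d ≠ 0) (hk : d < 2 * k) (q : ℝ≥0∞) :
    0 ≤ 1 - 2 * theta k d q := by
  have hk0 : k ≠ 0 := by omega
  rcases le_or_gt q (ENNReal.ofReal (critExp k d)) with hq | hq
  · rw [one_sub_two_mul_theta_of_le hd hq]
    positivity
  · have two_le : 2 ≤ q := by
      refine le_trans ?_ hq.le
      simpa using ENNReal.ofReal_le_ofReal (two_lt_critExp hd hk0).le
    have inv_le : q.toReal⁻¹ ≤ 2⁻¹ := by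
      simpa [ENNReal.toReal_inv] using ENNReal.toReal_mono (by simp) (ENNReal.inv_le_inv.2 two_le)
    have := mul_le_mul_of_nonneg_left inv_le (show (0 : ℝ) ≤ d / k by positivity)
    rw [one_sub_two_mul_theta_of_lt hk0 hq, sub_nonneg]
    exact this.trans_eq (by field_simp)

lemma eLpNorm_le_of_forall_abs_le {B : ℝ} (q : ℝ≥0∞)
    (h : ∀ x ∈ Set.Icc (0 : Fin d → ℝ) 1, |v x| ≤ B) :
    eLpNorm v q (torusMeasure d) ≤ ENNReal.ofReal B := by
  have ae_le : ∀ᵐ x ∂torusMeasure d, ‖v x‖ ≤ B := ae_restrict_of_forall_mem measurableSet_Icc h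
  simpa using eLpNorm_le_of_ae_bound (p := q) ae_le

lemma eLpNorm_critExp_le (hd : d ≠ 0) (hk : k ≠ 0) (hv : Continuous v) (hb : 0 < b) (hR : 0 ≤ R)
    {C : ℝ} (hC : 0 ≤ C)
    (h : ∫ x, |v x| ^ critExp k d ∂torusMeasure d ≤ C * (b ^ (critExp k d - 2) * R ^ 2)) :
    eLpNorm v (ENNReal.ofReal (critExp k d)) (torusMeasure d)
      ≤ ENNReal.ofReal (C ^ (critExp k d)⁻¹
        * (b ^ (1 - d / (2 * k + d) : ℝ) * R ^ (d / (2 * k + d) : ℝ))) := by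
  have hp := two_lt_critExp hd hk
  have two_div_eq : 2 * (critExp k d)⁻¹ = d / (2 * k + d) := by
    rw [critExp]
    field_simp
    ring
  rw [(memLp_torusMeasure_of_continuous hv _).eLpNorm_eq_integral_rpow_norm
    (by simpa using by linarith) ENNReal.ofReal_ne_top, ENNReal.toReal_ofReal (by linarith)]
  refine ENNReal.ofReal_le_ofReal ((Real.rpow_le_rpow (integral_nonneg fun x => by positivity) h
    (by positivity)).trans_eq ?_)
  rw [Real.mul_rpow hC (by positivity), Real.mul_rpow (by positivity) (by positivity),
    ← Real.rpow_mul hb.le, ← Real.rpow_natCast_mul hR, sub_mul, Nat.cast_two, two_div_eq,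
    mul_inv_cancel₀ (by linarith)]

lemma rpow_mul_rpow_one_sub_eq {C : ℝ} (hC : 0 ≤ C) (hb : 0 < b) (hR : 0 < R) (e₁ e₂ s : ℝ) :
    (C * (b ^ (1 - e₁) * R ^ e₁)) ^ s * (C * (b ^ (1 - e₂) * R ^ e₂)) ^ (1 - s)
      = C * (b ^ (1 - (e₁ * s + e₂ * (1 - s))) * R ^ (e₁ * s + e₂ * (1 - s))) := by
  have hC' : C ^ s * C ^ (1 - s) = C := by
    rw [← Real.rpow_add' hC (by norm_num), add_sub_cancel, Real.rpow_one]
  have hb' : 1 - (e₁ * s + e₂ * (1 - s)) = (1 - e₁) * s + (1 - e₂) * (1 - s) := by ring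
  simp only [Real.mul_rpow hC (mul_nonneg (Real.rpow_nonneg hb.le _) (Real.rpow_nonneg hR.le _)),
    Real.mul_rpow (Real.rpow_nonneg hb.le _) (Real.rpow_nonneg hR.le _), ← Real.rpow_mul hb.le,
    ← Real.rpow_mul hR.le, hb', Real.rpow_add hb, Real.rpow_add hR]
  linear_combination
    b ^ ((1 - e₁) * s) * b ^ ((1 - e₂) * (1 - s)) * R ^ (e₁ * s) * R ^ (e₂ * (1 - s)) * hC'

lemma eLpNorm_le_of_eLpNorm_critExp_le (hd : d ≠ 0) (hk : k ≠ 0) (hv : Continuous v) (hb : 0 < b)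
    (hR : 0 < R) {C : ℝ} (hC : 0 ≤ C)
    (hcrit : eLpNorm v (ENNReal.ofReal (critExp k d)) (torusMeasure d)
      ≤ ENNReal.ofReal (C * (b ^ (1 - d / (2 * k + d) : ℝ) * R ^ (d / (2 * k + d) : ℝ))))
    (htop : eLpNorm v ∞ (torusMeasure d)
      ≤ ENNReal.ofReal (C * (b ^ (1 - d / (2 * k) : ℝ) * R ^ (d / (2 * k) : ℝ)))) (q : ℝ≥0∞) :
    eLpNorm v q (torusMeasure d)
      ≤ ENNReal.ofReal (C * (b ^ (2 * theta k d q) * R ^ (1 - 2 * theta k d q))) := by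
  have hp := two_lt_critExp hd hk
  suffices h : eLpNorm v q (torusMeasure d) ≤ ENNReal.ofReal
      (C * (b ^ (1 - (1 - 2 * theta k d q)) * R ^ (1 - 2 * theta k d q))) by
    rwa [sub_sub_cancel] at h
  rcases le_or_gt q (ENNReal.ofReal (critExp k d)) with hq | hq
  · rw [one_sub_two_mul_theta_of_le hd hq]
    exact (eLpNorm_le_eLpNorm_of_exponent_le hq hv.aestronglyMeasurable).trans hcrit
  rcases eq_or_ne q ∞ with rfl | hq'
  · simpa [one_sub_two_mul_theta_of_lt hk hq] using htop
  obtain ⟨t, rfl⟩ : ∃ t, q = ENNReal.ofReal t := ⟨_, (ENNReal.ofReal_toReal hq').symm⟩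
  have hpt : critExp k d < t := (ENNReal.ofReal_lt_ofReal_iff_of_nonneg (by linarith)).1 hq
  set s := critExp k d / t with hs
  have hs0 : 0 < s := div_pos (by linarith) (by linarith)
  have hs1 : s < 1 := (div_lt_one (by linarith)).2 hpt
  have mul_eq : ENNReal.ofReal t * ENNReal.ofReal s = ENNReal.ofReal (critExp k d) := by
    rw [← ENNReal.ofReal_mul (by linarith), mul_div_cancel₀ _ (by linarith)]
  have exponent_eq : 1 - 2 * theta k d (ENNReal.ofReal t)
      = d / (2 * k + d) * s + d / (2 * k) * (1 - s) := by
    rw [one_sub_two_mul_theta_of_lt hk hq, ENNReal.toReal_ofReal (by linarith), hs, critExp]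
    field_simp
    ring
  rw [exponent_eq]
  refine (eLpNorm_le_rpow_mul_eLpNorm_top_rpow hv.aestronglyMeasurable _ hs0 hs1).trans ?_
  rw [mul_eq]
  refine (mul_le_mul' (ENNReal.rpow_le_rpow hcrit hs0.le)
    (ENNReal.rpow_le_rpow htop (sub_nonneg.2 hs1.le))).trans_eq ?_
  rw [ENNReal.ofReal_rpow_of_nonneg (by positivity) hs0.le,
    ENNReal.ofReal_rpow_of_nonneg (by positivity) (sub_nonneg.2 hs1.le),
    ← ENNReal.ofReal_mul (by positivity), rpow_mul_rpow_one_sub_eq hC hb hR]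

lemma exists_hasLocalBound (hd : d ≠ 0) {r : ℝ} (hr : 1 ≤ r) (hk : d / r < k) {c : ℝ}
    (hc : 1 < c) :
    ∃ K C₀ : ℝ, 1 ≤ K ∧ 1 ≤ C₀ ∧ ∀ 𝓑 : Set (Set (Fin d → ℝ)), IsNormalSystem c 𝓑 →
      ∀ (N : ℕ) (v : (Fin d → ℝ) → ℝ), 0 < N → ContDiff ℝ k v → ∀ b R : ℝ,
      multiresNorm 𝓑 (sample N v) ≤ b * Real.sqrt ((N : ℝ) ^ d) →
      ∫ x, derivSum k v x ^ 2 ∂torusMeasure d ≤ R ^ 2 →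
      HasLocalBound K C₀ k r N b R v (derivSum k v) := by
  obtain ⟨j, rfl⟩ : ∃ j, k = j + 1 := Nat.exists_eq_succ_of_ne_zero (by
    rintro rfl
    simp only [Nat.cast_zero] at hk
    exact hk.not_ge (by positivity))
  obtain ⟨K, C₀, hK, hC₀, hlocal⟩ := exists_local_estimate hd hr (mod_cast hk) hc
  refine ⟨K, C₀, hK, hC₀, fun 𝓑 h𝓑 N v hN hv b R hb hR =>
    ⟨continuous_derivSum hv, derivSum_nonneg _ v, hR, fun M hM hMN m y hy => ?_⟩⟩
  have hM' : (0 : ℝ) < M := by positivity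
  refine (hlocal 𝓑 h𝓑 N v (mod_cast hv) _ hb (gridPoint m) (M : ℝ)⁻¹ (by positivity)
    (gridCell_subset_Icc m) (by rwa [← div_eq_mul_inv, le_div_iff₀ hM']) y hy).trans_eq ?_
  rw [mul_div_assoc, ← Real.sqrt_div (by positivity), ← div_pow, ← div_eq_mul_inv,
    div_div_cancel₀ (by positivity), inv_pow]

theorem exists_eLpNorm_le_of_contDiff (hd : d ≠ 0) (hk : d < 2 * k) {c : ℝ} (hc : 1 < c) :
    ∃ C C₀ : ℝ, 0 < C ∧ 1 ≤ C₀ ∧ ∀ 𝓑 : Set (Set (Fin d → ℝ)), IsNormalSystem c 𝓑 →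
      ∀ (N : ℕ) (v : (Fin d → ℝ) → ℝ) (b R : ℝ), C₀ ≤ N → ContDiff ℝ k v →
      0 < b → b ≤ R → R ≤ b * (N : ℝ) ^ k →
      multiresNorm 𝓑 (sample N v) ≤ b * Real.sqrt ((N : ℝ) ^ d) →
      ∫ x, derivSum k v x ^ 2 ∂torusMeasure d ≤ R ^ 2 → ∀ q : ℝ≥0∞,
      eLpNorm v q (torusMeasure d)
        ≤ ENNReal.ofReal (C * (b ^ (2 * theta k d q) * R ^ (1 - 2 * theta k d q))) := by
  have hk0 : k ≠ 0 := by omega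
  have hd1 : (1 : ℝ) ≤ d := mod_cast Nat.one_le_iff_ne_zero.2 hd
  have hdk : (d : ℝ) + 1 ≤ 2 * k := mod_cast hk
  obtain ⟨r, hr1, hr2, hrk⟩ : ∃ r : ℝ, 1 ≤ r ∧ r < 2 ∧ d / r < k := by
    refine ⟨4 * d / (2 * d + 1), (one_le_div (by positivity)).2 (by linarith),
      (div_lt_iff₀ (by positivity)).2 (by linarith), ?_⟩
    rw [div_div_eq_mul_div, mul_comm, mul_div_mul_right _ _ (by positivity)]
    linarith
  obtain ⟨K, C₀, hK, hC₀, hlocal⟩ := exists_hasLocalBound hd hr1 hrk hc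
  have hr0 : 0 < r := by linarith
  have hK0 : 0 ≤ K := by linarith
  obtain ⟨C₁, hC₁, hint⟩ :=
    HasLocalBound.exists_integral_rpow_critExp_le hd hk0 hK0 hC₀ hr0 hr2
  set C := max (C₁ ^ (critExp k d)⁻¹) (K * (1 + (2 * C₀) ^ k))
  have hC : 0 < C := lt_max_of_lt_right (by positivity)
  refine ⟨C, C₀, hC, hC₀, fun 𝓑 h𝓑 N v b R hN hv hb hbR hRN hmr hR => ?_⟩
  have hR0 : 0 < R := hb.trans_le hbR
  have hN0 : 0 < N := Nat.cast_pos.1 (one_pos.trans_le (hC₀.trans hN))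
  have H := hlocal 𝓑 h𝓑 N v hN0 hv b R hmr hR
  refine eLpNorm_le_of_eLpNorm_critExp_le hd hk0 hv.continuous hb hR0 hC.le ?_ ?_
  · refine (eLpNorm_critExp_le hd hk0 hv.continuous hb hR0.le hC₁
      (hint H hv.continuous hN hb hbR hRN)).trans (ENNReal.ofReal_le_ofReal ?_)
    gcongr
    exact le_max_left _ _
  · refine eLpNorm_le_of_forall_abs_le ∞ fun y hy =>
      (H.abs_le_rpow hK0 hC₀ hN hr0 hr2.le hk0 hb hbR hRN hy).trans ?_
    gcongr
    exact le_max_right _ _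

end SmoothInterpolation

/-! ### The interpolation inequality for Sobolev functions -/

section SobolevInterpolation

variable {k d : ℕ} {f f' w u v : (Fin d → ℝ) → ℝ}

lemma sobolevNorm_nonneg (k : ℕ) (f : (Fin d → ℝ) → ℝ) : 0 ≤ sobolevNorm k f :=
  Real.sqrt_nonneg _

lemma sobolevInner_self_nonneg (k : ℕ) (f : (Fin d → ℝ) → ℝ) : 0 ≤ sobolevInner k f f :=
  Finset.sum_nonneg fun _ _ => integral_nonneg fun _ => mul_self_nonneg _

lemma sobolevNorm_sq (k : ℕ) (f : (Fin d → ℝ) → ℝ) : sobolevNorm k f ^ 2 = sobolevInner k f f :=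
  Real.sq_sqrt (sobolevInner_self_nonneg k f)

lemma exists_contDiff_approx (hk : d < 2 * k) (hu : u ∈ SobolevZero k d) {ε : ℝ} (hε : 0 < ε) :
    ∃ v, ContDiff ℝ k v ∧ (∀ x, |u x - v x| ≤ ε) ∧
      ∫ x, derivSum k v x ^ 2 ∂torusMeasure d
        ≤ (Real.sqrt ((d : ℝ) ^ k) * sobolevNorm k u) ^ 2 := by
  obtain ⟨F, hF⟩ := exists_trigPoly_approx hk hu hε
  refine ⟨trigPoly F (fourierCoef u), contDiff_trigPoly F _, hF, ?_⟩
  rw [mul_pow, Real.sq_sqrt (by positivity), sobolevNorm_sq]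
  exact integral_sq_derivSum_trigPoly_le hu F

lemma multiresNorm_sample_le_add (𝓑 : Set (Set (Fin d → ℝ))) (N : ℕ) {ε : ℝ} (hε : 0 ≤ ε)
    (h : ∀ x, |u x - v x| ≤ ε) :
    multiresNorm 𝓑 (sample N v) ≤ multiresNorm 𝓑 (sample N u) + ε * Real.sqrt ((N : ℝ) ^ d) := by
  have sub_le : multiresNorm 𝓑 (sample N v - sample N u) ≤ ε * Real.sqrt ((N : ℝ) ^ d) :=
    multiresNorm_le_of_forall_abs_le 𝓑 hε fun τ => (abs_sub_comm _ _).trans_le (h (gridPoint τ))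
  calc multiresNorm 𝓑 (sample N v)
      = multiresNorm 𝓑 (sample N u + (sample N v - sample N u)) := by rw [add_sub_cancel]
    _ ≤ _ := (multiresNorm_add_le 𝓑 _ _).trans (by gcongr)

lemma mul_rpow_mul_mul_rpow {D b R θ : ℝ} (hD : 0 ≤ D) (hb : 0 ≤ b) (hR : 0 ≤ R) :
    (D * b) ^ θ * (D * R) ^ (1 - θ) = D * (b ^ θ * R ^ (1 - θ)) := by
  rw [Real.mul_rpow hD hb, Real.mul_rpow hD hR, mul_mul_mul_comm,
    ← Real.rpow_add' hD (by norm_num), add_sub_cancel, Real.rpow_one]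

lemma le_ofReal_of_forall_pos {A : ℝ≥0∞} {C b R θ : ℝ} (hθ : 0 ≤ θ) (hθ' : 0 ≤ 1 - θ)
    (h : ∀ ε > 0, A ≤ ENNReal.ofReal (C * ((b + ε) ^ θ * (R + ε) ^ (1 - θ)) + ε)) :
    A ≤ ENNReal.ofReal (C * (b ^ θ * R ^ (1 - θ))) := by
  have hcont : Continuous fun ε : ℝ =>
      ENNReal.ofReal (C * ((b + ε) ^ θ * (R + ε) ^ (1 - θ)) + ε) := by
    refine ENNReal.continuous_ofReal.comp ((continuous_const.mul (.mul ?_ ?_)).add continuous_id)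
    · exact (continuous_const.add continuous_id).rpow_const fun _ => Or.inr hθ
    · exact (continuous_const.add continuous_id).rpow_const fun _ => Or.inr hθ'
  have hlim := (hcont.tendsto 0).mono_left (nhdsWithin_le_nhds (s := Set.Ioi 0))
  simp only [add_zero] at hlim
  exact ge_of_tendsto hlim (eventually_nhdsWithin_of_forall h)

theorem exists_eLpNorm_le (hd : d ≠ 0) (hk : d < 2 * k) {c : ℝ} (hc : 1 < c) :
    ∃ C C₀ : ℝ, 0 < C ∧ 1 ≤ C₀ ∧ ∀ 𝓑 : Set (Set (Fin d → ℝ)), IsNormalSystem c 𝓑 →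
      ∀ (N : ℕ) (u : (Fin d → ℝ) → ℝ) (b R : ℝ), C₀ ≤ N → u ∈ SobolevZero k d →
      0 ≤ b → b ≤ R → R ≤ b * (N : ℝ) ^ k →
      multiresNorm 𝓑 (sample N u) ≤ b * Real.sqrt ((N : ℝ) ^ d) → sobolevNorm k u ≤ R →
      ∀ q : ℝ≥0∞, 1 ≤ q → eLpNorm u q (torusMeasure d)
        ≤ ENNReal.ofReal (C * (b ^ (2 * theta k d q) * R ^ (1 - 2 * theta k d q))) := by
  obtain ⟨C, C₀, hC, hC₀, hsmooth⟩ := exists_eLpNorm_le_of_contDiff hd hk hc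
  set D : ℝ := Real.sqrt ((d : ℝ) ^ k)
  have hD : 1 ≤ D := Real.one_le_sqrt.2 (one_le_pow₀ (mod_cast Nat.one_le_iff_ne_zero.2 hd))
  refine ⟨C * D, C₀, by positivity, hC₀, fun 𝓑 h𝓑 N u b R hN hu hb hbR hRN hmr hR q hq => ?_⟩
  have hR0 : 0 ≤ R := hb.trans hbR
  have hNk : 1 ≤ (N : ℝ) ^ k := one_le_pow₀ (hC₀.trans hN)
  have hθ := theta_pos hd hk q
  have hθ' := one_sub_two_mul_theta_nonneg hd hk q
  have eLpNorm_le (ε : ℝ) (hε : 0 < ε) : eLpNorm u q (torusMeasure d) ≤ ENNReal.ofReal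
      (C * D * ((b + ε) ^ (2 * theta k d q) * (R + ε) ^ (1 - 2 * theta k d q)) + ε) := by
    obtain ⟨v, hv, huv, hderiv⟩ := exists_contDiff_approx hk hu hε
    have smooth_le := hsmooth 𝓑 h𝓑 N v (D * (b + ε)) (D * (R + ε)) hN hv (by positivity)
      (by gcongr)
      (by
        rw [mul_assoc, add_mul]
        gcongr
        exact le_mul_of_one_le_right hε.le hNk)
      (by
        refine (multiresNorm_sample_le_add 𝓑 N hε.le huv).trans ?_
        rw [mul_assoc]
        refine le_trans ?_ (le_mul_of_one_le_left (by positivity) hD)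
        linarith)
      (hderiv.trans (by
        have := sobolevNorm_nonneg k u
        gcongr
        linarith)) q
    rw [mul_rpow_mul_mul_rpow (by positivity) (by positivity) (by linarith),
      ← mul_assoc] at smooth_le
    have sub_le : eLpNorm (u - v) q (torusMeasure d) ≤ ENNReal.ofReal ε :=
      eLpNorm_le_of_forall_abs_le q fun x _ => huv x
    calc eLpNorm u q (torusMeasure d) = eLpNorm (v + (u - v)) q (torusMeasure d) := by
          rw [add_sub_cancel]
      _ ≤ eLpNorm v q (torusMeasure d) + eLpNorm (u - v) q (torusMeasure d) :=
          eLpNorm_add_le hv.continuous.aestronglyMeasurable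
            (hu.1.sub hv.continuous).aestronglyMeasurable hq
      _ ≤ _ := by
          rw [ENNReal.ofReal_add (by positivity) hε.le]
          exact add_le_add smooth_le sub_le
  exact le_ofReal_of_forall_pos (by positivity) hθ' eLpNorm_le

/-! ### The Sobolev error -/

lemma integrable_weakDeriv_mul (hu : u ∈ SobolevZero k d) (hv : v ∈ SobolevZero k d)
    (I : Fin k → Fin d) :
    Integrable (fun x => weakDeriv I u x * weakDeriv I v x) (torusMeasure d) :=
  (SobolevZero.isWeakDeriv hu I).1.integrable_mul (SobolevZero.isWeakDeriv hv I).1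

lemma sobolevInner_comm (k : ℕ) (u v : (Fin d → ℝ) → ℝ) :
    sobolevInner k u v = sobolevInner k v u := by
  simp only [sobolevInner, mul_comm]

lemma sobolevInner_sub_left (hu : u ∈ SobolevZero k d) (hv : v ∈ SobolevZero k d)
    (hw : w ∈ SobolevZero k d) :
    sobolevInner k (u - v) w = sobolevInner k u w - sobolevInner k v w := by
  rw [sobolevInner, sobolevInner, sobolevInner, ← Finset.sum_sub_distrib]
  refine Finset.sum_congr rfl fun I _ => ?_
  rw [← integral_sub (integrable_weakDeriv_mul hu hw I) (integrable_weakDeriv_mul hv hw I)]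
  refine integral_congr_ae ?_
  filter_upwards [SobolevZero.weakDeriv_sub hu hv I] with x hx
  rw [hx, Pi.sub_apply, sub_mul]

lemma sobolevInner_sub_right (hu : u ∈ SobolevZero k d) (hv : v ∈ SobolevZero k d)
    (hw : w ∈ SobolevZero k d) :
    sobolevInner k w (u - v) = sobolevInner k w u - sobolevInner k w v := by
  simp only [sobolevInner_comm k w, sobolevInner_sub_left hu hv hw]

lemma sobolevInner_zero_right (hu : u ∈ SobolevZero k d) : sobolevInner k u 0 = 0 := by
  rw [← sub_self u, sobolevInner_sub_right hu hu hu, sub_self]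

/-- Expands `‖D^k (f' - f)‖² ≤ 2 ⟨f' - f, w - f⟩ - 2 ⟨f' - f, w⟩` and bounds the first product by
Young's inequality. -/
lemma sobolevNorm_sub_sq_le (hf : f ∈ SobolevZero k d) (hf' : f' ∈ SobolevZero k d)
    (hw : w ∈ SobolevZero k d) (h : sobolevNorm k f' ≤ sobolevNorm k f) :
    sobolevNorm k (f' - f) ^ 2 ≤ 4 * sobolevNorm k (w - f) ^ 2 - 4 * sobolevInner k (f' - f) w := by
  have hu := SobolevZero.sub_mem hf' hf
  have he := SobolevZero.sub_mem hw hf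
  have hue := SobolevZero.sub_mem hu he
  have young := sobolevInner_self_nonneg k (f' - f - (w - f) - (w - f))
  have sq_le := pow_le_pow_left₀ (sobolevNorm_nonneg k f') h 2
  simp only [sobolevNorm_sq] at sq_le ⊢
  simp only [sobolevInner_sub_left, sobolevInner_sub_right, hf, hf', hw, hu, he, hue,
    SobolevZero.sub_mem, sobolevInner_comm k w, sobolevInner_comm k f f'] at young ⊢
  linarith

end SobolevInterpolation

section Estimator

variable {k d N : ℕ} {𝓑 : Set (Set (Fin d → ℝ))} {f f' : (Fin d → ℝ) → ℝ}
  {y : (Fin d → Fin N) → ℝ} {γ : ℝ}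

lemma neg_sum_mul_le_of_multiresNorm_lt {ω u : (Fin d → Fin N) → ℝ} {t : ℝ≥0}
    (hω : dualMultiresNorm 𝓑 ω ≤ t) {s : ℝ} (hs : multiresNorm 𝓑 u < s) :
    -∑ τ, u τ * ω τ ≤ s * t := by
  have hs0 : 0 < s := (multiresNorm_nonneg _ _).trans_lt hs
  have multiresNorm_le_one : multiresNorm 𝓑 (-s⁻¹ • u) ≤ 1 := by
    refine (multiresNorm_smul_le _ _ _).trans ?_
    rw [abs_neg, abs_of_pos (inv_pos.2 hs0), inv_mul_le_iff₀ hs0, mul_one]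
    exact hs.le
  have sum_le : ∑ τ, ω τ * (-s⁻¹ • u) τ ≤ t := by
    have := (le_iSup₂ (f := fun (v : (Fin d → Fin N) → ℝ) (_ : multiresNorm 𝓑 v ≤ 1) =>
      ENNReal.ofReal (∑ τ, ω τ * v τ)) _ multiresNorm_le_one).trans hω
    simpa using (ENNReal.ofReal_le_iff_le_toReal ENNReal.coe_ne_top).1 this
  have sum_eq : ∑ τ, ω τ * (-s⁻¹ • u) τ = s⁻¹ * -∑ τ, u τ * ω τ := by
    rw [mul_neg, ← neg_mul, Finset.mul_sum]
    refine Finset.sum_congr rfl fun τ _ => ?_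
    rw [Pi.smul_apply, smul_eq_mul]
    ring
  rwa [sum_eq, inv_mul_le_iff₀ hs0] at sum_le

lemma neg_sum_mul_le {ω u : (Fin d → Fin N) → ℝ} {t : ℝ≥0} (hω : dualMultiresNorm 𝓑 ω ≤ t)
    {s : ℝ} (hs : multiresNorm 𝓑 u ≤ s) : -∑ τ, u τ * ω τ ≤ s * t := by
  have hlim : Filter.Tendsto (fun s' : ℝ => s' * (t : ℝ)) (nhdsWithin s (Set.Ioi s))
      (nhds (s * t)) := ((continuous_mul_const _).tendsto s).mono_left nhdsWithin_le_nhds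
  exact ge_of_tendsto hlim (eventually_nhdsWithin_of_forall fun s' hs' =>
    neg_sum_mul_le_of_multiresNorm_lt hω (hs.trans_lt hs'))

lemma multiresNorm_sample_sub_le (h : multiresNorm 𝓑 (sample N f - y) ≤ γ)
    (h' : multiresNorm 𝓑 (sample N f' - y) ≤ γ) :
    multiresNorm 𝓑 (sample N (f' - f)) ≤ 2 * γ := by
  have sample_eq : sample N (f' - f) = sample N f' - y + (-1 : ℝ) • (sample N f - y) := by
    ext τ
    simp [sample]
  have smul_le := multiresNorm_smul_le 𝓑 (-1) (sample N f - y)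
  rw [abs_neg, abs_one, one_mul] at smul_le
  rw [sample_eq]
  linarith [multiresNorm_add_le 𝓑 (sample N f' - y) ((-1 : ℝ) • (sample N f - y))]

lemma cMin_nonneg (k : ℕ) {d : ℕ} (N : ℕ) (𝓑 : Set (Set (Fin d → ℝ))) (f : (Fin d → ℝ) → ℝ)
    (γ : ℝ) : 0 ≤ cMin k N 𝓑 f γ := by
  refine Real.iInf_nonneg fun t => add_nonneg (Real.sInf_nonneg ?_) (Real.sqrt_nonneg _)
  rintro r ⟨ω, w, -, -, rfl⟩
  exact sobolevNorm_nonneg k _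

lemma sobolevNorm_sub_le_cMin (hf : f ∈ SobolevZero k d) (hf' : f' ∈ SobolevZero k d)
    (h : multiresNorm 𝓑 (sample N f - y) ≤ γ) (h' : multiresNorm 𝓑 (sample N f' - y) ≤ γ)
    (hle : sobolevNorm k f' ≤ sobolevNorm k f) :
    sobolevNorm k (f' - f) ≤ 3 * cMin k N 𝓑 f γ := by
  have hγ : 0 ≤ γ := (multiresNorm_nonneg _ _).trans h
  rw [← div_le_iff₀' three_pos]
  refine le_ciInf fun t => ?_
  rw [← sub_le_iff_le_add]
  refine le_csInf ⟨_, 0, 0, ?_, ⟨SobolevZero.zero_mem k d, fun u hu => ?_⟩, rfl⟩ ?_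
  · simp [dualMultiresNorm]
  · simp [sobolevInner_zero_right hu]
  · rintro r ⟨ω, w, hω, ⟨hw, hadj⟩, rfl⟩
    have dual_le := neg_sum_mul_le hω (multiresNorm_sample_sub_le h h')
    rw [hadj _ (SobolevZero.sub_mem hf' hf)] at dual_le
    have sq_le : sobolevNorm k (f' - f) ^ 2
        ≤ (3 * (sobolevNorm k (w - f) + Real.sqrt (γ * t))) ^ 2 := by
      nlinarith [sobolevNorm_sub_sq_le hf hf' hw hle, Real.sq_sqrt (mul_nonneg hγ t.coe_nonneg),
        mul_nonneg (sobolevNorm_nonneg k (w - f)) (Real.sqrt_nonneg (γ * t))]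
    have norm_le := le_of_sq_le_sq sq_le (mul_nonneg zero_le_three
      (add_nonneg (sobolevNorm_nonneg k _) (Real.sqrt_nonneg _)))
    linarith

lemma IsMINDEstimator.sobolevNorm_le (hf' : IsMINDEstimator k 𝓑 y γ f')
    (hf : f ∈ SobolevZero k d) (h : multiresNorm 𝓑 (sample N f - y) ≤ γ) :
    sobolevNorm k f' ≤ sobolevNorm k f :=
  le_of_sq_le_sq (le_of_mul_le_mul_left (hf'.2 f hf h) one_half_pos) (sobolevNorm_nonneg k f)

end Estimator

/-! ### The rate -/

section Rate

variable {k d N : ℕ} {γ ρ : ℝ}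

lemma div_pow_rpow_mul_rpow_eq (hd : d ≠ 0) (q : ℝ≥0∞) (hρ : 0 ≤ ρ) :
    (ρ / (N : ℝ) ^ k) ^ (2 * theta k d q) * ρ ^ (1 - 2 * theta k d q)
      = ρ / ((N : ℝ) ^ d) ^ theta' k d q := by
  have exponent_eq : k * (2 * theta k d q) = d * theta' k d q := by
    rw [theta']
    field_simp
  rw [Real.div_rpow hρ (by positivity), div_mul_eq_mul_div, ← Real.rpow_add' hρ (by norm_num),
    add_sub_cancel, Real.rpow_one, ← Real.rpow_natCast_mul (by positivity),
    ← Real.rpow_natCast_mul (by positivity), exponent_eq]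

lemma div_sqrt_rpow_mul_rpow_eq (hγ : 0 ≤ γ) (n θ : ℝ) (hn : 0 ≤ n) :
    (γ / Real.sqrt n) ^ (2 * θ) * ρ ^ (1 - 2 * θ) = γ ^ (2 * θ) * ρ ^ (1 - 2 * θ) / n ^ θ := by
  rw [Real.div_rpow hγ (Real.sqrt_nonneg n), Real.sqrt_eq_rpow, ← Real.rpow_mul hn,
    div_mul_eq_mul_div, ← mul_assoc, one_div_mul_cancel two_ne_zero, one_mul]

lemma interpolation_le_max_rate (hd : d ≠ 0) (hN : 1 ≤ N) (q : ℝ≥0∞) (hγ : 0 ≤ γ)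
    (hρ : 0 ≤ ρ) :
    max (γ / Real.sqrt ((N : ℝ) ^ d)) (ρ / (N : ℝ) ^ k) ^ (2 * theta k d q)
        * max (γ / Real.sqrt ((N : ℝ) ^ d)) ρ ^ (1 - 2 * theta k d q)
      ≤ max (γ ^ (2 * theta k d q) * ρ ^ (1 - 2 * theta k d q) / ((N : ℝ) ^ d) ^ theta k d q)
        (max (γ / ((N : ℝ) ^ d) ^ (1 / 2 : ℝ)) (ρ / ((N : ℝ) ^ d) ^ theta' k d q)) := by
  have div_le : ρ / (N : ℝ) ^ k ≤ ρ := div_le_self hρ (one_le_pow₀ (mod_cast hN))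
  rw [← Real.sqrt_eq_rpow, ← div_sqrt_rpow_mul_rpow_eq hγ _ _ (by positivity),
    ← div_pow_rpow_mul_rpow_eq hd q hρ]
  rcases le_total ρ (γ / Real.sqrt ((N : ℝ) ^ d)) with h | h
  · rw [max_eq_left h, max_eq_left (div_le.trans h), ← Real.rpow_add' (by positivity) (by norm_num),
      add_sub_cancel, Real.rpow_one]
    exact (le_max_left _ _).trans (le_max_right _ _)
  · rw [max_eq_right h]
    rcases max_choice (γ / Real.sqrt ((N : ℝ) ^ d)) (ρ / (N : ℝ) ^ k) with h' | h' <;> rw [h']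
    · exact le_max_left _ _
    · exact (le_max_right _ _).trans (le_max_right _ _)

theorem exists_eLpNorm_sub_le (hd : d ≠ 0) (hk : d < 2 * k) {c : ℝ} (hc : 1 < c) :
    ∃ C C₀ : ℝ, 0 < C ∧ 1 ≤ C₀ ∧ ∀ (q : ℝ≥0∞), 1 ≤ q →
      ∀ 𝓑 : Set (Set (Fin d → ℝ)), IsNormalSystem c 𝓑 → ∀ N : ℕ, C₀ ≤ N →
      ∀ (f f' : (Fin d → ℝ) → ℝ) (y : (Fin d → Fin N) → ℝ) (γ : ℝ),
        f ∈ SobolevZero k d → f' ∈ SobolevZero k d →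
        multiresNorm 𝓑 (sample N f - y) ≤ γ → multiresNorm 𝓑 (sample N f' - y) ≤ γ →
        sobolevNorm k f' ≤ sobolevNorm k f →
      eLpNorm (f' - f) q (torusMeasure d) ≤ ENNReal.ofReal (C *
        (max (γ / Real.sqrt ((N : ℝ) ^ d)) (cMin k N 𝓑 f γ / (N : ℝ) ^ k) ^ (2 * theta k d q)
          * max (γ / Real.sqrt ((N : ℝ) ^ d)) (cMin k N 𝓑 f γ) ^ (1 - 2 * theta k d q))) := by
  obtain ⟨C, C₀, hC, hC₀, hinterp⟩ := exists_eLpNorm_le hd hk hc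
  refine ⟨C * 3, C₀, by positivity, hC₀, fun q hq 𝓑 h𝓑 N hN f f' y γ hf hf' h h' hle => ?_⟩
  have hN1 : 1 ≤ (N : ℝ) := hC₀.trans hN
  have hNk : 1 ≤ (N : ℝ) ^ k := one_le_pow₀ hN1
  have hγ : 0 ≤ γ := (multiresNorm_nonneg _ _).trans h
  have hρ := cMin_nonneg k N 𝓑 f γ
  have norm_le := sobolevNorm_sub_le_cMin hf hf' h h' hle
  have sample_le := multiresNorm_sample_sub_le h h'
  set ρ := cMin k N 𝓑 f γ
  set α := γ / Real.sqrt ((N : ℝ) ^ d) with hα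
  have hα0 : 0 ≤ α := by positivity
  rw [mul_assoc, ← mul_rpow_mul_mul_rpow zero_le_three (by positivity) (by positivity)]
  refine hinterp 𝓑 h𝓑 N (f' - f) _ _ hN (SobolevZero.sub_mem hf' hf) (by positivity) ?_ ?_ ?_ ?_
    q hq
  · gcongr
    exact div_le_self hρ hNk
  · rw [mul_assoc, max_mul_of_nonneg _ _ (by positivity), div_mul_cancel₀ _ (by positivity)]
    gcongr
    exact le_mul_of_one_le_right hα0 hNk
  · calc multiresNorm 𝓑 (sample N (f' - f)) ≤ 2 * γ := sample_le
      _ ≤ 3 * γ := by gcongr; norm_num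
      _ = 3 * α * Real.sqrt ((N : ℝ) ^ d) := by
        rw [mul_assoc, hα, div_mul_cancel₀ _ (by positivity)]
      _ ≤ _ := by
        gcongr
        exact le_max_left _ _
  · exact norm_le.trans (by gcongr; exact le_max_right _ _)

end Rate

end MIND

end

theorem mainTheorem1_general (k d : ℕ) (hd : 1 ≤ d) (hk : (d : ℝ) / 2 < k) (c : ℝ) (hc : 1 < c) :
    ∃ C : ℝ, 0 < C ∧ ∃ n₀ : ℕ,
      ∀ (q : ℝ≥0∞), 1 ≤ q →
      ∀ 𝓑 : Set (Set (Fin d → ℝ)), MIND.IsNormalSystem c 𝓑 →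
      ∀ n N : ℕ, n = N ^ d → n₀ ≤ n →
      ∀ (f : (Fin d → ℝ) → ℝ) (y : (Fin d → Fin N) → ℝ) (γ : ℝ),
        f ∈ MIND.SobolevZero k d →
        MIND.multiresNorm 𝓑 (MIND.sample N f - y) ≤ γ →
      ∀ f' : (Fin d → ℝ) → ℝ, f' ∈ MIND.SobolevZero k d →
        MIND.multiresNorm 𝓑 (MIND.sample N f' - y) ≤ γ →
        MIND.sobolevNorm k f' ≤ MIND.sobolevNorm k f →
        eLpNorm (f' - f) q (MIND.torusMeasure d) ≤
          ENNReal.ofReal (C *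
            max (γ ^ (2 * MIND.theta k d q) *
                  MIND.cMin k N 𝓑 f γ ^ (1 - 2 * MIND.theta k d q) / (n : ℝ) ^ MIND.theta k d q)
              (max (γ / (n : ℝ) ^ (1 / 2 : ℝ))
                (MIND.cMin k N 𝓑 f γ / (n : ℝ) ^ MIND.theta' k d q))) := by
  have hd0 : d ≠ 0 := Nat.one_le_iff_ne_zero.1 hd
  have hk' : d < 2 * k := by
    rw [div_lt_iff₀' two_pos] at hk
    exact_mod_cast hk
  obtain ⟨C, C₀, hC, hC₀, hbound⟩ := MIND.exists_eLpNorm_sub_le hd0 hk' hc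
  refine ⟨C, hC, ⌈C₀⌉₊ ^ d, ?_⟩
  rintro q hq 𝓑 h𝓑 n N rfl hn f y γ hf h f' hf' h' hle
  have hN : C₀ ≤ N := (Nat.le_ceil C₀).trans (mod_cast (Nat.pow_le_pow_iff_left hd0).1 hn)
  rw [Nat.cast_pow]
  refine (hbound q hq 𝓑 h𝓑 N hN f f' y γ hf hf' h h' hle).trans ?_
  gcongr
  exact MIND.interpolation_le_max_rate hd0 (mod_cast hC₀.trans hN) q
    ((MIND.multiresNorm_nonneg _ _).trans h) (MIND.cMin_nonneg k N 𝓑 f γ)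

theorem mainTheorem1 (k d : ℕ) (hd : 1 ≤ d) (hk : (d : ℝ) / 2 < k) (c : ℝ) (hc : 1 < c) :
    ∃ C : ℝ, 0 < C ∧ ∃ n₀ : ℕ,
      ∀ (q : ℝ≥0∞), 1 ≤ q →
      ∀ 𝓑 : Set (Set (Fin d → ℝ)), MIND.IsNormalSystem c 𝓑 →
      ∀ n N : ℕ, n = N ^ d → n₀ ≤ n →
      ∀ (f : (Fin d → ℝ) → ℝ) (y : (Fin d → Fin N) → ℝ) (γ : ℝ),
        f ∈ MIND.SobolevZero k d →
        MIND.multiresNorm 𝓑 (MIND.sample N f - y) ≤ γ →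
      ∀ f' : (Fin d → ℝ) → ℝ, MIND.IsMINDEstimator k 𝓑 y γ f' →
        eLpNorm (f' - f) q (MIND.torusMeasure d) ≤
          ENNReal.ofReal (C *
            max (γ ^ (2 * MIND.theta k d q) *
                  MIND.cMin k N 𝓑 f γ ^ (1 - 2 * MIND.theta k d q) / (n : ℝ) ^ MIND.theta k d q)
              (max (γ / (n : ℝ) ^ (1 / 2 : ℝ))
                (MIND.cMin k N 𝓑 f γ / (n : ℝ) ^ MIND.theta' k d q))) := by
  obtain ⟨C, hC, n₀, hbound⟩ := mainTheorem1_general k d hd hk c hc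
  exact ⟨C, hC, n₀, fun q hq 𝓑 h𝓑 n N hn hn₀ f y γ hf h f' hf' =>
    hbound q hq 𝓑 h𝓑 n N hn hn₀ f y γ hf h f' hf'.1.1 hf'.1.2
      (MIND.IsMINDEstimator.sobolevNorm_le hf' hf h)⟩
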